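/- Let $\mathbb H$ be the real quaternions, with coordinates $x=x_0+x_1i+x_2j+x_3k$, and let $\Delta=\sum_{l=0}^{3}\partial_{x_l}^2$, $\partial=\tfrac12(\partial_{x_0}+i\partial_{x_1}+j\partial_{x_2}+k\partial_{x_3})$ and $\overline\partial=\tfrac12(\partial_{x_0}-i\partial_{x_1}-j\partial_{x_2}-k\partial_{x_3})$ (the Cauchy–Riemann–Fueter operator and its conjugate). Let $D\subseteq\mathbb C$ be open and invariant under complex conjugation, and let $\Omega=\{\alpha+J\beta : \alpha+i\beta\in D,\ J\in\mathbb H,\ J^2=-1\}$ be the corresponding axially symmetric open set. A function $f$ on $\Omega$ is a slice function if $f(\alpha+J\beta)=F_1(\alpha+i\beta)+JF_2(\alpha+i\beta)$ for a stem function $F=F_1+iF_2:D\to\mathbb H\otimes\mathbb C$, i.e. one with $F(\bar z)=\overline{F(z)}$. It is slice-regular if $F$ is holomorphic. Its slice derivative $\partial f/\partial x$ is the function induced by $\partial F/\partial z$. Let $\mathcal{SR}(\Omega)$ be the set of slice-regular functions on $\Omega$, and $\mathcal{AM}(\Omega)$ the set of axially monogenic functions, i.e. slice functions of class $C^1$ on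 $\Omega$ with $\partial f=0$. For $n\ge 0$ let $P_n(x)=-\tfrac14\Delta(x^{n+2})$. Then: 1. $\Delta$ maps $\mathcal{SR}(\Omega)$ into $\mathcal{AM}(\Omega)$ and $\partial/\partial x$ maps $\mathcal{SR}(\Omega)$ into itself. 2. Let $\mathcal P(\Omega)$ be the set of functions on $\Omega$ that are sums of pointwise convergent series $\sum_n P_n(x)a_n$ with $a_n\in\mathbb H$; it contains every $P_n$. The operator $$\sum_n P_n(x)a_n\ \longmapsto\ -\tfrac14\sum_n x^{n+2}a_n$$ is well defined on $\mathcal P(\Omega)$ (the series on the right is summable at every point of $\Omega$ and its sum on $\Omega$ depends only on the function $\sum_n P_na_n$), and it is a right inverse of $\Delta$: one has $\mathcal P(\Omega)\subseteq\mathcal{AM}(\Omega)$, the operator has values in $\mathcal{SR}(\Omega)$, and applying $\Delta$ to its value gives back the function. 3. For every $n\ge1$, $\overline\partial P_n=(n+2)P_{n-1}$ on $\mathbb H$. 4. Let $\mathcal M\subseteq\mathcal{AM}(\Omega)$ and let $\widetilde\Delta:\mathcal M\to\mathcal{SR}(\Omega)$ be any right inverse of $\Delta$ on $\mathcal M$,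 i.e. $\Delta\widetilde\Delta f=f$ on $\Omega$ for all $f\in\mathcal M$ (for instance $\mathcal M=\mathcal{AM}(\Omega)$ whenever a right inverse exists there, or the operator of part 2). Put $\mathcal L=\Delta\circ\frac{\partial}{\partial x}\circ\widetilde\Delta$. Then $\mathcal L(P_n)=(n+2)P_{n-1}$ on $\Omega$ for every $n\ge1$ with $P_n\in\mathcal M$, and for every $f\in\mathcal M$ one has $\mathcal L f\in\mathcal{AM}(\Omega)$ and $\mathcal L f=\overline\partial f$ on $\Omega$. 5. For every $g\in\mathcal{SR}(\Omega)$, $\overline\partial(\Delta g)=\Delta\!\left(\frac{\partial g}{\partial x}\right)$ on $\Omega$. -/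

import Mathlib

open scoped Quaternion Laplacian ComplexConjugate

noncomputable section

namespace SliceAnalysis

/-- The imaginary units `i`, `j`, `k` of the real quaternions. -/
def qi : ℍ[ℝ] := ⟨0, 1, 0, 0⟩
def qj : ℍ[ℝ] := ⟨0, 0, 1, 0⟩
def qk : ℍ[ℝ] := ⟨0, 0, 0, 1⟩

/-- The axially symmetric set `Ω_D = {α + Jβ : α + iβ ∈ D, J² = -1}`. -/
def axial (D : Set ℂ) : Set ℍ[ℝ] :=
  {x | ∃ z ∈ D, ∃ J : ℍ[ℝ], J * J = -1 ∧ x = (z.re : ℍ[ℝ]) + J * (z.im : ℍ[ℝ])}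

/-- A function `F = F₁ + i F₂` from `D` to `ℍ ⊗ ℂ` is given by its two `ℍ`-valued components;
it is a stem function when `F (conj z) = conj (F z)` on `D`. -/
def IsStem (D : Set ℂ) (F₁ F₂ : ℂ → ℍ[ℝ]) : Prop :=
  ∀ z ∈ D, F₁ (conj z) = F₁ z ∧ F₂ (conj z) = -F₂ z

/-- `f` restricted to `Ω_D` is the function induced by `F₁ + i F₂`. -/
def Induces (D : Set ℂ) (F₁ F₂ : ℂ → ℍ[ℝ]) (f : ℍ[ℝ] → ℍ[ℝ]) : Prop :=
  ∀ z ∈ D, ∀ J : ℍ[ℝ], J * J = -1 → f ((z.re : ℍ[ℝ]) + J * (z.im : ℍ[ℝ])) = F₁ z + J * F₂ z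

/-- The partial derivatives with respect to `α` and `β` on `ℂ`, where `z = α + iβ`. -/
def dα (F : ℂ → ℍ[ℝ]) (z : ℂ) : ℍ[ℝ] := fderiv ℝ F z 1
def dβ (F : ℂ → ℍ[ℝ]) (z : ℂ) : ℍ[ℝ] := fderiv ℝ F z Complex.I

/-- Holomorphy of `F₁ + i F₂ : D → ℍ ⊗ ℂ` for the complex structure of the second factor:
real differentiability and the Cauchy-Riemann equations. -/
def HolomorphicStem (D : Set ℂ) (F₁ F₂ : ℂ → ℍ[ℝ]) : Prop :=
  ∀ z ∈ D, DifferentiableAt ℝ F₁ z ∧ DifferentiableAt ℝ F₂ z ∧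
    dα F₁ z = dβ F₂ z ∧ dβ F₁ z = -dα F₂ z

/-- Slice functions on `Ω_D`. As everywhere below, functions on `Ω_D` are represented by functions
on `ℍ` whose values outside `Ω_D` are irrelevant. -/
def SliceFunctions (D : Set ℂ) : Set (ℍ[ℝ] → ℍ[ℝ]) :=
  {f | ∃ F₁ F₂, IsStem D F₁ F₂ ∧ Induces D F₁ F₂ f}

/-- Slice-regular functions on `Ω_D`. -/
def SR (D : Set ℂ) : Set (ℍ[ℝ] → ℍ[ℝ]) :=
  {f | ∃ F₁ F₂, IsStem D F₁ F₂ ∧ HolomorphicStem D F₁ F₂ ∧ Induces D F₁ F₂ f}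

/-- The components of the stem function of a slice function `f`. -/
def stemRe (f : ℍ[ℝ] → ℍ[ℝ]) (z : ℂ) : ℍ[ℝ] :=
  (2⁻¹ : ℝ) • (f ((z.re : ℍ[ℝ]) + qi * (z.im : ℍ[ℝ])) + f ((z.re : ℍ[ℝ]) + -qi * (z.im : ℍ[ℝ])))
def stemIm (f : ℍ[ℝ] → ℍ[ℝ]) (z : ℂ) : ℍ[ℝ] :=
  -((2⁻¹ : ℝ) • (qi *
    (f ((z.re : ℍ[ℝ]) + qi * (z.im : ℍ[ℝ])) - f ((z.re : ℍ[ℝ]) + -qi * (z.im : ℍ[ℝ])))))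

theorem qi_mul_qi : qi * qi = -1 := by
  have h0 : qi.re = 0 := rfl
  have h1 : qi.imI = 1 := rfl
  have h2 : qi.imJ = 0 := rfl
  have h3 : qi.imK = 0 := rfl
  ext <;> simp [h0, h1, h2, h3]

/-- The inducing function of a slice function is unique, and `stemRe`, `stemIm` recover it. -/
theorem Induces.stem_eq {D : Set ℂ} {F₁ F₂ : ℂ → ℍ[ℝ]} {f : ℍ[ℝ] → ℍ[ℝ]}
    (h : Induces D F₁ F₂ f) {z : ℂ} (hz : z ∈ D) : stemRe f z = F₁ z ∧ stemIm f z = F₂ z := by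
  have h1 := h z hz qi qi_mul_qi
  have h2 := h z hz (-qi) (by rw [neg_mul_neg, qi_mul_qi])
  have e1 : F₁ z + qi * F₂ z + (F₁ z + -qi * F₂ z) = (2 : ℝ) • F₁ z := by
    rw [two_smul, neg_mul]; abel
  have e2 : qi * (F₁ z + qi * F₂ z - (F₁ z + -qi * F₂ z)) = -((2 : ℝ) • F₂ z) := by
    have : F₁ z + qi * F₂ z - (F₁ z + -qi * F₂ z) = qi * F₂ z + qi * F₂ z := by
      rw [neg_mul]; abel
    rw [this, mul_add, ← mul_assoc, qi_mul_qi, two_smul, neg_one_mul]; abel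
  constructor
  · rw [stemRe, h1, h2, e1, smul_smul]; norm_num
  · rw [stemIm, h1, h2, e2, smul_neg, neg_neg, smul_smul]; norm_num

/-- The function `x = α + Jβ ↦ G₁(α + iβ) + J G₂(α + iβ)`, computed with `β = |Im x|` and
`J = Im x / |Im x|` (at real `x` only `G₁` contributes, as `G₂ = 0` there for stem functions). -/
def sliceFun (G₁ G₂ : ℂ → ℍ[ℝ]) (x : ℍ[ℝ]) : ℍ[ℝ] :=
  G₁ ⟨x.re, ‖x.im‖⟩ + (‖x.im‖⁻¹ • x.im) * G₂ ⟨x.re, ‖x.im‖⟩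

/-- The slice derivative `∂f/∂x`: the function induced by `∂F/∂z = ½ (∂_α - i ∂_β) F`, where
`F = F₁ + i F₂` is the stem function of `f`. -/
def sliceDeriv (f : ℍ[ℝ] → ℍ[ℝ]) : ℍ[ℝ] → ℍ[ℝ] :=
  sliceFun
    (fun z => (2⁻¹ : ℝ) • (dα (stemRe f) z + dβ (stemIm f) z))
    (fun z => (2⁻¹ : ℝ) • (dα (stemIm f) z - dβ (stemRe f) z))

/-- The Cauchy-Riemann-Fueter operator `∂`. -/
def fueter (f : ℍ[ℝ] → ℍ[ℝ]) (x : ℍ[ℝ]) : ℍ[ℝ] :=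
  (2⁻¹ : ℝ) • (fderiv ℝ f x 1 + qi * fderiv ℝ f x qi + qj * fderiv ℝ f x qj + qk * fderiv ℝ f x qk)

/-- The conjugated Cauchy-Riemann-Fueter operator. -/
def conjFueter (f : ℍ[ℝ] → ℍ[ℝ]) (x : ℍ[ℝ]) : ℍ[ℝ] :=
  (2⁻¹ : ℝ) • (fderiv ℝ f x 1 - qi * fderiv ℝ f x qi - qj * fderiv ℝ f x qj - qk * fderiv ℝ f x qk)

/-- Axially monogenic functions on `Ω_D`: slice functions of class `C¹` in the kernel of `∂`. -/
def AM (D : Set ℂ) : Set (ℍ[ℝ] → ℍ[ℝ]) :=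
  {f | f ∈ SliceFunctions D ∧ ContDiffOn ℝ 1 f (axial D) ∧ ∀ x ∈ axial D, fueter f x = 0}

/-- The polynomials `P_n = -¼ Δ(x^{n+2})`. -/
def P (n : ℕ) : ℍ[ℝ] → ℍ[ℝ] := -((4⁻¹ : ℝ) • Δ (fun x : ℍ[ℝ] => x ^ (n + 2)))

/-- `T` is a right inverse of `Δ : SR(Ω_D) → AM(Ω_D)` on the class `M` of axially monogenic
functions (`M = AM D` being the case of a right inverse on all of `AM(Ω_D)`). -/
structure IsRightInverse (D : Set ℂ) (M : Set (ℍ[ℝ] → ℍ[ℝ]))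
    (T : (ℍ[ℝ] → ℍ[ℝ]) → ℍ[ℝ] → ℍ[ℝ]) : Prop where
  subset_AM : M ⊆ AM D
  mem_SR : ∀ f ∈ M, T f ∈ SR D
  laplacian_eq : ∀ f ∈ M, ∀ x ∈ axial D, Δ (T f) x = f x

/-- The operator `L = Δ ∘ ∂/∂x ∘ T`. -/
def L (T : (ℍ[ℝ] → ℍ[ℝ]) → ℍ[ℝ] → ℍ[ℝ]) (f : ℍ[ℝ] → ℍ[ℝ]) : ℍ[ℝ] → ℍ[ℝ] :=
  Δ (sliceDeriv (T f))

/-- `f = ∑ P_n a_n` on `Ω_D`, as a pointwise convergent series. -/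
def HasPExpansion (D : Set ℂ) (f : ℍ[ℝ] → ℍ[ℝ]) (a : ℕ → ℍ[ℝ]) : Prop :=
  ∀ x ∈ axial D, Filter.Tendsto (fun N => ∑ n ∈ Finset.range N, P n x * a n) Filter.atTop
    (nhds (f x))

/-- The functions on `Ω_D` that are sums of convergent series `∑ P_n a_n`. -/
def PSeries (D : Set ℂ) : Set (ℍ[ℝ] → ℍ[ℝ]) := {f | ∃ a, HasPExpansion D f a}

open Classical in
/-- The explicit operator `∑ P_n a_n ↦ -¼ ∑ x^{n+2} a_n`. -/
def lapInv (D : Set ℂ) (f : ℍ[ℝ] → ℍ[ℝ]) : ℍ[ℝ] → ℍ[ℝ] :=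
  if h : f ∈ PSeries D then
    fun x => -((4⁻¹ : ℝ) • ∑' n, x ^ (n + 2) * h.choose n)
  else 0

end SliceAnalysis

end

open SliceAnalysis

/-! Write `β = ‖x.im‖`. Everything rests on two facts about a slice-regular `g` with stem `F₁ +
iF₂`. Off the real axis the Cauchy–Riemann equations cancel almost all of the Fueter derivatives:
`∂g = -F₂/β` and `∂̄g = g' + F₂/β`, with `g'` the slice derivative (`fueter_slice`,
`conjFueter_slice`). Moreover the spherical derivative `F₂/β` is harmonic there (`laplacian_divIm`).
Since `Δ = 4∂∂̄ = 4∂̄∂` commutes with `∂` and `∂̄`, it follows that `∂Δg = 0` and `∂̄Δg = Δg'`. Both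
identities extend to real points by continuity, once `g` is known to be smooth there; this holds
because the stem has real-coefficient power series in its four coordinates (`Induces.contDiffAt`).
The operator `L` is then immediate: apply `∂̄Δg = Δg'` to `g = T f`.

For the polynomials, two first-order steps give `P n = zonalSum (n + 2)`, and the recurrences for
`zonal` and `zonalSum` yield the Appell rule for `∂̄`.

For the series, multiplying `P n` by `x - x̄` bounds `P n` below by a positive multiple of `‖x‖ ^ n`
at nonreal `x` (`le_norm_zonalSum`). Convergence at one nonreal point therefore bounds `‖a n‖ * R ^
n`. Every point of `Ω` has smaller norm than some nonreal point of `Ω`, so `∑ x ^ (n + 2) a_n`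
converges absolutely there and may be differentiated termwise. Coefficients are unique because `P n`
is homogeneous and nonzero at nonreal points, which reduces the question to the identity theorem in
one real variable. -/

noncomputable section

namespace SliceAnalysis

open Filter Topology

/-! ### The Fueter operators and their factorization of the Laplacian -/

section Operators

@[simp] theorem re_qi : qi.re = 0 := rfl
@[simp] theorem imI_qi : qi.imI = 1 := rfl
@[simp] theorem imJ_qi : qi.imJ = 0 := rfl
@[simp] theorem imK_qi : qi.imK = 0 := rfl
@[simp] theorem re_qj : qj.re = 0 := rfl
@[simp] theorem imI_qj : qj.imI = 0 := rfl
@[simp] theorem imJ_qj : qj.imJ = 1 := rfl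
@[simp] theorem imK_qj : qj.imK = 0 := rfl
@[simp] theorem re_qk : qk.re = 0 := rfl
@[simp] theorem imI_qk : qk.imI = 0 := rfl
@[simp] theorem imJ_qk : qk.imJ = 0 := rfl
@[simp] theorem imK_qk : qk.imK = 1 := rfl

theorem qj_mul_qj : qj * qj = -1 := by ext <;> simp
theorem qk_mul_qk : qk * qk = -1 := by ext <;> simp
theorem qi_mul_qj : qi * qj = qk := by ext <;> simp
theorem qj_mul_qi : qj * qi = -qk := by ext <;> simp
theorem qj_mul_qk : qj * qk = qi := by ext <;> simp
theorem qk_mul_qj : qk * qj = -qi := by ext <;> simp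
theorem qk_mul_qi : qk * qi = qj := by ext <;> simp
theorem qi_mul_qk : qi * qk = -qj := by ext <;> simp

/-- The orthonormal basis `1, i, j, k` of the quaternions. -/
def quaternionBasis : OrthonormalBasis (Fin 4) ℝ ℍ[ℝ] :=
  OrthonormalBasis.ofRepr Quaternion.linearIsometryEquivTuple

theorem quaternionBasis_apply : (quaternionBasis : Fin 4 → ℍ[ℝ]) = ![1, qi, qj, qk] := by
  funext l
  rw [← OrthonormalBasis.repr_symm_single, LinearIsometryEquiv.symm_apply_eq]
  have h (q : ℍ[ℝ]) : quaternionBasis.repr q = !₂[q.re, q.imI, q.imJ, q.imK] := rfl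
  rw [h]
  ext m
  fin_cases l <;> fin_cases m <;> simp

variable {f g : ℍ[ℝ] → ℍ[ℝ]} {x : ℍ[ℝ]}

theorem laplacian_apply (f : ℍ[ℝ] → ℍ[ℝ]) (x : ℍ[ℝ]) :
    Δ f x = fderiv ℝ (fderiv ℝ f) x 1 1 + fderiv ℝ (fderiv ℝ f) x qi qi +
      fderiv ℝ (fderiv ℝ f) x qj qj + fderiv ℝ (fderiv ℝ f) x qk qk := by
  rw [InnerProductSpace.laplacian_eq_iteratedFDeriv_orthonormalBasis f quaternionBasis]
  simp only [Fin.sum_univ_four, quaternionBasis_apply, iteratedFDeriv_two_apply]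
  rfl

theorem fueter_congr (h : f =ᶠ[𝓝 x] g) : fueter f x = fueter g x := by
  rw [fueter, fueter, h.fderiv_eq]

theorem conjFueter_congr (h : f =ᶠ[𝓝 x] g) : conjFueter f x = conjFueter g x := by
  rw [conjFueter, conjFueter, h.fderiv_eq]

theorem _root_.HasFDerivAt.fueter {f' : ℍ[ℝ] →L[ℝ] ℍ[ℝ]} (h : HasFDerivAt f f' x) :
    fueter f x = (2⁻¹ : ℝ) • (f' 1 + qi * f' qi + qj * f' qj + qk * f' qk) := by
  rw [SliceAnalysis.fueter, h.fderiv]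

theorem _root_.HasFDerivAt.conjFueter {f' : ℍ[ℝ] →L[ℝ] ℍ[ℝ]} (h : HasFDerivAt f f' x) :
    conjFueter f x = (2⁻¹ : ℝ) • (f' 1 - qi * f' qi - qj * f' qj - qk * f' qk) := by
  rw [SliceAnalysis.conjFueter, h.fderiv]

theorem fueter_const_smul (c : ℝ) (f : ℍ[ℝ] → ℍ[ℝ]) (x : ℍ[ℝ]) :
    fueter (c • f) x = c • fueter f x := by
  simp only [fueter, fderiv_const_smul_field, Pi.smul_apply, smul_apply, mul_smul_comm,
    ← smul_add]
  rw [smul_comm]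

theorem conjFueter_const_smul (c : ℝ) (f : ℍ[ℝ] → ℍ[ℝ]) (x : ℍ[ℝ]) :
    conjFueter (c • f) x = c • conjFueter f x := by
  simp only [conjFueter, fderiv_const_smul_field, Pi.smul_apply, smul_apply, mul_smul_comm,
    ← smul_sub]
  rw [smul_comm]

theorem conjFueter_neg (f : ℍ[ℝ] → ℍ[ℝ]) (x : ℍ[ℝ]) : conjFueter (-f) x = -conjFueter f x := by
  have := conjFueter_const_smul (-1) f x
  simpa using this

theorem conjFueter_add (hf : DifferentiableAt ℝ f x) (hg : DifferentiableAt ℝ g x) :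
    conjFueter (f + g) x = conjFueter f x + conjFueter g x := by
  simp only [conjFueter, fderiv_add hf hg, add_apply, mul_add, ← smul_add]
  congr 1; abel

theorem contDiffAt_fderiv_apply {n m : WithTop ℕ∞} (h : ContDiffAt ℝ n f x) (hm : m + 1 ≤ n)
    (v : ℍ[ℝ]) : ContDiffAt ℝ m (fun y => fderiv ℝ f y v) x :=
  (h.fderiv_right hm).clm_apply contDiffAt_const

theorem _root_.ContDiffAt.fueter {n m : WithTop ℕ∞} (h : ContDiffAt ℝ n f x) (hm : m + 1 ≤ n) :
    ContDiffAt ℝ m (fueter f) x := by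
  have H := contDiffAt_fderiv_apply h hm
  exact ((((H 1).add (contDiffAt_const.mul (H qi))).add
    (contDiffAt_const.mul (H qj))).add (contDiffAt_const.mul (H qk))).const_smul (2⁻¹ : ℝ)

theorem _root_.ContDiffAt.conjFueter {n m : WithTop ℕ∞} (h : ContDiffAt ℝ n f x) (hm : m + 1 ≤ n) :
    ContDiffAt ℝ m (conjFueter f) x := by
  have H := contDiffAt_fderiv_apply h hm
  exact ((((H 1).sub (contDiffAt_const.mul (H qi))).sub
    (contDiffAt_const.mul (H qj))).sub (contDiffAt_const.mul (H qk))).const_smul (2⁻¹ : ℝ)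

theorem _root_.ContDiffAt.quaternion_laplacian {n m : WithTop ℕ∞} (h : ContDiffAt ℝ n f x)
    (hm : m + 2 ≤ n) : ContDiffAt ℝ m (Δ f) x := by
  have H : ∀ v, ContDiffAt ℝ m (fun y => fderiv ℝ (fderiv ℝ f) y v v) x := fun v =>
    (((h.fderiv_right (m := m + 1) (by rwa [add_assoc, one_add_one_eq_two])).fderiv_right
      le_rfl).clm_apply contDiffAt_const).clm_apply contDiffAt_const
  exact ((((H 1).add (H qi)).add (H qj)).add (H qk)).congr_of_eventuallyEq
    (Eventually.of_forall fun y => laplacian_apply f y)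

theorem hasFDerivAt_fderiv_apply (h : ContDiffAt ℝ 2 f x) (v : ℍ[ℝ]) :
    HasFDerivAt (fun y => fderiv ℝ f y v) ((fderiv ℝ (fderiv ℝ f) x).flip v) x := by
  have h2 : DifferentiableAt ℝ (fderiv ℝ f) x :=
    (h.fderiv_right (m := 1) (by norm_num)).differentiableAt one_ne_zero
  simpa using h2.hasFDerivAt.clm_apply (hasFDerivAt_const v x)

theorem hasFDerivAt_fueter (h : ContDiffAt ℝ 2 f x) :
    ∃ A : ℍ[ℝ] →L[ℝ] ℍ[ℝ], HasFDerivAt (fueter f) A x ∧ ∀ v,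
      A v = (2⁻¹ : ℝ) • (fderiv ℝ (fderiv ℝ f) x v 1 + qi * fderiv ℝ (fderiv ℝ f) x v qi +
        qj * fderiv ℝ (fderiv ℝ f) x v qj + qk * fderiv ℝ (fderiv ℝ f) x v qk) := by
  have H := hasFDerivAt_fderiv_apply h
  refine ⟨_, ((((H 1).add ((H qi).const_mul qi)).add ((H qj).const_mul qj)).add
    ((H qk).const_mul qk)).const_smul (2⁻¹ : ℝ), fun v => ?_⟩
  simp

theorem hasFDerivAt_conjFueter (h : ContDiffAt ℝ 2 f x) :
    ∃ A : ℍ[ℝ] →L[ℝ] ℍ[ℝ], HasFDerivAt (conjFueter f) A x ∧ ∀ v,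
      A v = (2⁻¹ : ℝ) • (fderiv ℝ (fderiv ℝ f) x v 1 - qi * fderiv ℝ (fderiv ℝ f) x v qi -
        qj * fderiv ℝ (fderiv ℝ f) x v qj - qk * fderiv ℝ (fderiv ℝ f) x v qk) := by
  have H := hasFDerivAt_fderiv_apply h
  refine ⟨_, ((((H 1).sub ((H qi).const_mul qi)).sub ((H qj).const_mul qj)).sub
    ((H qk).const_mul qk)).const_smul (2⁻¹ : ℝ), fun v => ?_⟩
  simp

/-- The mixed terms cancel: second derivatives are symmetric while distinct imaginary units
anticommute, and the real-imaginary terms occur with opposite signs. -/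
theorem conjFueter_fueter (h : ContDiffAt ℝ 2 f x) :
    conjFueter (fueter f) x = (4⁻¹ : ℝ) • Δ f x := by
  obtain ⟨A, hA, hv⟩ := hasFDerivAt_fueter h
  have hs : IsSymmSndFDerivAt ℝ f x := h.isSymmSndFDerivAt (by simp)
  rw [hA.conjFueter, laplacian_apply]
  simp only [hv, hs.eq qi 1, hs.eq qj 1, hs.eq qk 1, hs.eq qj qi, hs.eq qk qi, hs.eq qk qj]
  simp only [mul_smul_comm, mul_add, ← mul_assoc, qi_mul_qi, qj_mul_qj, qk_mul_qk, qi_mul_qj,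
    qj_mul_qi, qj_mul_qk, qk_mul_qj, qk_mul_qi, qi_mul_qk, neg_mul, one_mul]
  module

theorem fueter_conjFueter (h : ContDiffAt ℝ 2 f x) :
    fueter (conjFueter f) x = (4⁻¹ : ℝ) • Δ f x := by
  obtain ⟨A, hA, hv⟩ := hasFDerivAt_conjFueter h
  have hs : IsSymmSndFDerivAt ℝ f x := h.isSymmSndFDerivAt (by simp)
  rw [hA.fueter, laplacian_apply]
  simp only [hv, hs.eq qi 1, hs.eq qj 1, hs.eq qk 1, hs.eq qj qi, hs.eq qk qi, hs.eq qk qj]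
  simp only [mul_smul_comm, mul_sub, ← mul_assoc, qi_mul_qi, qj_mul_qj, qk_mul_qk, qi_mul_qj,
    qj_mul_qi, qj_mul_qk, qk_mul_qj, qk_mul_qi, qi_mul_qk, neg_mul, one_mul]
  module

theorem laplacian_eq_conjFueter_fueter (h : ContDiffAt ℝ 2 f x) :
    Δ f x = (4 : ℝ) • conjFueter (fueter f) x := by
  rw [conjFueter_fueter h, smul_smul]; norm_num

theorem laplacian_eq_fueter_conjFueter (h : ContDiffAt ℝ 2 f x) :
    Δ f x = (4 : ℝ) • fueter (conjFueter f) x := by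
  rw [fueter_conjFueter h, smul_smul]; norm_num

/-- Having both factorizations avoids third derivatives: `∂(4∂̄∂f) = 4∂∂̄(∂f)`. -/
theorem fueter_laplacian (h : ContDiffAt ℝ 3 f x) : fueter (Δ f) x = Δ (fueter f) x := by
  have h2 : ContDiffAt ℝ 2 (fueter f) x := h.fueter (by norm_num)
  have h3 : ∀ᶠ y in 𝓝 x, ContDiffAt ℝ 2 f y :=
    (h.of_le (by norm_num)).eventually (by simp)
  rw [laplacian_eq_fueter_conjFueter h2, ← fueter_const_smul]
  exact fueter_congr (h3.mono fun y hy => laplacian_eq_conjFueter_fueter hy)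

theorem conjFueter_laplacian (h : ContDiffAt ℝ 3 f x) :
    conjFueter (Δ f) x = Δ (conjFueter f) x := by
  have h2 : ContDiffAt ℝ 2 (conjFueter f) x := h.conjFueter (by norm_num)
  have h3 : ∀ᶠ y in 𝓝 x, ContDiffAt ℝ 2 f y :=
    (h.of_le (by norm_num)).eventually (by simp)
  rw [laplacian_eq_conjFueter_fueter h2, ← conjFueter_const_smul]
  exact conjFueter_congr (h3.mono fun y hy => laplacian_eq_fueter_conjFueter hy)

end Operators

/-! ### Slice coordinates and first derivatives off the real axis -/

section FirstDerivatives

theorem unit_re_norm {J : ℍ[ℝ]} (hJ : J * J = -1) : J.re = 0 ∧ ‖J‖ = 1 := by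
  constructor
  · have h0 := congrArg QuaternionAlgebra.re hJ
    have h1 := congrArg QuaternionAlgebra.imI hJ
    have h2 := congrArg QuaternionAlgebra.imJ hJ
    have h3 := congrArg QuaternionAlgebra.imK hJ
    simp at h0 h1 h2 h3
    -- The imaginary coordinates of `J * J = -1` read `2 J₀ Jₗ = 0`, so a nonzero real part would
    -- make `J` real with square `-1`.
    by_contra h
    have h1' : J.imI = 0 := mul_left_cancel₀ h (by linarith)
    have h2' : J.imJ = 0 := mul_left_cancel₀ h (by linarith)
    have h3' : J.imK = 0 := mul_left_cancel₀ h (by linarith)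
    rw [h1', h2', h3'] at h0
    nlinarith [mul_self_nonneg J.re]
  · have h := congrArg norm hJ
    rw [norm_mul, norm_neg, norm_one] at h
    nlinarith [norm_nonneg J]

theorem unit_neg {J : ℍ[ℝ]} (hJ : J * J = -1) : -J * -J = -1 := by rw [neg_mul_neg, hJ]

theorem im_mul_im (x : ℍ[ℝ]) : x.im * x.im = -((‖x.im‖ ^ 2 : ℝ) : ℍ[ℝ]) := by
  rw [sq ‖x.im‖, ← Quaternion.normSq_eq_norm_mul_self, ← sq, Quaternion.im_sq]

/-- The point of the closed upper half plane corresponding to a quaternion. -/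
def toUpper (x : ℍ[ℝ]) : ℂ := ⟨x.re, ‖x.im‖⟩

/-- The imaginary unit of a nonreal quaternion. -/
def unitIm (x : ℍ[ℝ]) : ℍ[ℝ] := ‖x.im‖⁻¹ • x.im

theorem sliceFun_apply (G₁ G₂ : ℂ → ℍ[ℝ]) (x : ℍ[ℝ]) :
    sliceFun G₁ G₂ x = G₁ (toUpper x) + unitIm x * G₂ (toUpper x) := rfl

theorem unitIm_mul_unitIm {x : ℍ[ℝ]} (hx : x.im ≠ 0) : unitIm x * unitIm x = -1 := by
  have h : ‖x.im‖ ≠ 0 := norm_ne_zero_iff.2 hx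
  rw [unitIm, smul_mul_smul_comm, im_mul_im, smul_neg, ← Quaternion.coe_smul, smul_eq_mul]
  congr 1
  rw [← Quaternion.coe_one]
  congr 1
  field_simp

theorem re_add_unitIm_mul (x : ℍ[ℝ]) :
    ((toUpper x).re : ℍ[ℝ]) + unitIm x * ((toUpper x).im : ℍ[ℝ]) = x := by
  change (x.re : ℍ[ℝ]) + (‖x.im‖⁻¹ • x.im) * ((‖x.im‖ : ℝ) : ℍ[ℝ]) = x
  rw [← Quaternion.coe_commutes, Quaternion.coe_mul_eq_smul, smul_smul]
  rcases eq_or_ne x.im 0 with h | h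
  · rw [h, smul_zero, ← h, Quaternion.re_add_im]
  · rw [mul_inv_cancel₀ (norm_ne_zero_iff.2 h), one_smul, Quaternion.re_add_im]

/-- At real `x` the value `unitIm x` is `0`, not a unit; any unit works there, and `qi` is taken. -/
theorem exists_unit (x : ℍ[ℝ]) : ∃ J : ℍ[ℝ], J * J = -1 ∧
    ((toUpper x).re : ℍ[ℝ]) + J * ((toUpper x).im : ℍ[ℝ]) = x ∧
    (x.im ≠ 0 → J = unitIm x) := by
  by_cases h : x.im = 0
  · refine ⟨qi, qi_mul_qi, ?_, fun h' => absurd h h'⟩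
    conv_rhs => rw [← re_add_unitIm_mul x]
    have : (toUpper x).im = 0 := by simp [toUpper, h]
    simp [this]
  · exact ⟨unitIm x, unitIm_mul_unitIm h, re_add_unitIm_mul x, fun _ => rfl⟩

theorem re_slice {J : ℍ[ℝ]} (hJ : J * J = -1) (a b : ℝ) : ((a : ℍ[ℝ]) + J * (b : ℍ[ℝ])).re = a := by
  simp [(unit_re_norm hJ).1]

theorem im_slice {J : ℍ[ℝ]} (hJ : J * J = -1) (a b : ℝ) :
    ((a : ℍ[ℝ]) + J * (b : ℍ[ℝ])).im = b • J := by
  have := (unit_re_norm hJ).1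
  ext <;> simp [this, mul_comm]

theorem norm_im_slice {J : ℍ[ℝ]} (hJ : J * J = -1) (a b : ℝ) :
    ‖((a : ℍ[ℝ]) + J * (b : ℍ[ℝ])).im‖ = |b| := by
  rw [im_slice hJ, norm_smul, (unit_re_norm hJ).2, mul_one, Real.norm_eq_abs]

theorem toUpper_slice {J : ℍ[ℝ]} (hJ : J * J = -1) (a b : ℝ) :
    toUpper ((a : ℍ[ℝ]) + J * (b : ℍ[ℝ])) = ⟨a, |b|⟩ := by
  rw [toUpper, re_slice hJ, norm_im_slice hJ]

theorem unitIm_slice_of_pos {J : ℍ[ℝ]} (hJ : J * J = -1) (a : ℝ) {b : ℝ} (hb : 0 < b) :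
    unitIm ((a : ℍ[ℝ]) + J * (b : ℍ[ℝ])) = J := by
  rw [unitIm, norm_im_slice hJ, im_slice hJ, abs_of_pos hb, smul_smul, inv_mul_cancel₀ hb.ne',
    one_smul]

theorem slice_conj (J : ℍ[ℝ]) (z : ℂ) :
    (((conj z).re : ℝ) : ℍ[ℝ]) + -J * (((conj z).im : ℝ) : ℍ[ℝ]) = (z.re : ℍ[ℝ]) + J * (z.im : ℍ[ℝ]) := by
  simp

/-! ### Axially symmetric sets and induced functions -/

section Domain

variable {D : Set ℂ}

theorem mem_axial (hconj : ∀ z ∈ D, conj z ∈ D) {x : ℍ[ℝ]} : x ∈ axial D ↔ toUpper x ∈ D := by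
  constructor
  · rintro ⟨z, hz, J, hJ, rfl⟩
    rw [toUpper_slice hJ]
    rcases le_total 0 z.im with h | h
    · rwa [abs_of_nonneg h]
    · rw [abs_of_nonpos h]; exact hconj z hz
  · intro h
    obtain ⟨J, hJ, h1, -⟩ := exists_unit x
    exact ⟨_, h, J, hJ, h1.symm⟩

theorem continuous_toUpper : Continuous toUpper := by
  have : toUpper = fun x : ℍ[ℝ] => (x.re : ℂ) + (‖x.im‖ : ℂ) * Complex.I := by
    funext x; apply Complex.ext <;> simp [toUpper]
  rw [this]
  have := Quaternion.continuous_re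
  have := Quaternion.continuous_im
  fun_prop

theorem isOpen_axial (hD : IsOpen D) (hconj : ∀ z ∈ D, conj z ∈ D) : IsOpen (axial D) := by
  have : axial D = toUpper ⁻¹' D := Set.ext fun x => mem_axial hconj
  rw [this]
  exact hD.preimage continuous_toUpper

theorem IsStem.sliceFun {G₁ G₂ : ℂ → ℍ[ℝ]} (h : IsStem D G₁ G₂) : Induces D G₁ G₂ (sliceFun G₁ G₂) := by
  have key : ∀ z : ℂ, 0 < z.im → ∀ J : ℍ[ℝ], J * J = -1 →
      SliceAnalysis.sliceFun G₁ G₂ ((z.re : ℍ[ℝ]) + J * (z.im : ℍ[ℝ])) = G₁ z + J * G₂ z := by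
    intro z hp J hJ
    rw [sliceFun_apply, toUpper_slice hJ, unitIm_slice_of_pos hJ _ hp, abs_of_pos hp]
  intro z hz J hJ
  -- The pairs `(z, J)` and `(conj z, -J)` describe the same point, which reduces the lower half
  -- plane to the upper one. On the real line the stem condition forces `G₂ z = 0`, so the unit
  -- plays no role.
  rcases lt_trichotomy z.im 0 with hn | h0 | hp
  · have hs := h z hz
    rw [← slice_conj, key (conj z) (by simpa using hn) (-J) (unit_neg hJ), hs.1, hs.2, neg_mul_neg]
  · have hz' : conj z = z := Complex.conj_eq_iff_im.2 h0
    have h2 := (h z hz).2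
    rw [hz'] at h2
    have h3 : G₂ z = 0 := by
      have : (2 : ℝ) • G₂ z = 0 := by
        rw [two_smul]
        nth_rewrite 1 [h2]
        exact neg_add_cancel _
      exact (smul_eq_zero.1 this).resolve_left two_ne_zero
    have : toUpper ((z.re : ℍ[ℝ]) + J * (z.im : ℍ[ℝ])) = z := by
      rw [toUpper_slice hJ, h0, abs_zero, ← h0]
    rw [sliceFun_apply, this, h3, mul_zero, mul_zero]
  · exact key z hp J hJ

theorem Induces.eq_sliceFun {G₁ G₂ : ℂ → ℍ[ℝ]} {f : ℍ[ℝ] → ℍ[ℝ]} (h : Induces D G₁ G₂ f)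
    (hs : IsStem D G₁ G₂) {x : ℍ[ℝ]} (hx : x ∈ axial D) : f x = SliceAnalysis.sliceFun G₁ G₂ x := by
  obtain ⟨z, hz, J, hJ, rfl⟩ := hx
  rw [h z hz J hJ, hs.sliceFun z hz J hJ]

theorem Induces.congr {G₁ G₂ : ℂ → ℍ[ℝ]} {f g : ℍ[ℝ] → ℍ[ℝ]} (h : Induces D G₁ G₂ f)
    (hfg : ∀ x ∈ axial D, f x = g x) : Induces D G₁ G₂ g := fun z hz J hJ => by
  rw [← hfg _ ⟨z, hz, J, hJ, rfl⟩, h z hz J hJ]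

/-- A function is a slice function as soon as on each sphere it is affine in the imaginary unit. -/
theorem mem_sliceFunctions (hconj : ∀ z ∈ D, conj z ∈ D) {f : ℍ[ℝ] → ℍ[ℝ]}
    (h : ∀ z ∈ D, 0 < z.im → ∃ A B : ℍ[ℝ], ∀ J : ℍ[ℝ], J * J = -1 →
      f ((z.re : ℍ[ℝ]) + J * (z.im : ℍ[ℝ])) = A + J * B) :
    f ∈ SliceFunctions D := by
  refine ⟨stemRe f, stemIm f, fun z _ => ?_, fun z hz J hJ => ?_⟩
  · constructor
    · simp only [stemRe, Complex.conj_re, Complex.conj_im, Quaternion.coe_neg, mul_neg, neg_mul,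
        neg_neg]
      rw [add_comm]
    · simp only [stemIm, Complex.conj_re, Complex.conj_im, Quaternion.coe_neg, mul_neg, neg_mul,
        neg_neg]
      rw [← smul_neg, ← mul_neg, neg_sub]
  · have : ∃ A B : ℍ[ℝ], ∀ J : ℍ[ℝ], J * J = -1 →
        f ((z.re : ℍ[ℝ]) + J * (z.im : ℍ[ℝ])) = A + J * B := by
      rcases lt_trichotomy z.im 0 with hn | h0 | hp
      · obtain ⟨A, B, hAB⟩ := h (conj z) (hconj z hz) (by simpa using hn)
        refine ⟨A, -B, fun J hJ => ?_⟩
        rw [← slice_conj, hAB (-J) (unit_neg hJ), neg_mul, mul_neg]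
      · exact ⟨f z.re, 0, fun J _ => by simp [h0]⟩
      · exact h z hz hp
    obtain ⟨A, B, hAB⟩ := this
    have hi : Induces {z} (fun _ => A) (fun _ => B) f := by
      rintro w rfl J hJ
      exact hAB J hJ
    have := hi.stem_eq (Set.mem_singleton z)
    rw [this.1, this.2, hAB J hJ]

end Domain

/-- The real part as a continuous linear map. -/
def reL : ℍ[ℝ] →L[ℝ] ℝ :=
  LinearMap.toContinuousLinearMap
    { toFun := fun x => x.re, map_add' := fun _ _ => by simp, map_smul' := fun _ _ => by simp }

/-- The imaginary part as a continuous linear map. -/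
def imL : ℍ[ℝ] →L[ℝ] ℍ[ℝ] :=
  LinearMap.toContinuousLinearMap
    { toFun := fun x => x.im, map_add' := fun _ _ => by simp, map_smul' := fun _ _ => by simp }

@[simp] theorem reL_apply (x : ℍ[ℝ]) : reL x = x.re := rfl
@[simp] theorem imL_apply (x : ℍ[ℝ]) : imL x = x.im := rfl

/-- The derivative of `x ↦ ‖Im x‖`. -/
def normImDeriv (x : ℍ[ℝ]) : ℍ[ℝ] →L[ℝ] ℝ := ‖x.im‖⁻¹ • (innerSL ℝ x.im).comp imL

theorem normImDeriv_apply (x h : ℍ[ℝ]) :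
    normImDeriv x h = ‖x.im‖⁻¹ * (x.imI * h.imI + x.imJ * h.imJ + x.imK * h.imK) := by
  change ‖x.im‖⁻¹ * inner ℝ x.im h.im = _
  congr 1
  simp [Quaternion.inner_def]
  ring

theorem hasFDerivAt_norm_im {x : ℍ[ℝ]} (hx : x.im ≠ 0) :
    HasFDerivAt (fun y : ℍ[ℝ] => ‖y.im‖) (normImDeriv x) x := by
  have h1 : HasFDerivAt (fun y : ℍ[ℝ] => ‖y.im‖ ^ 2) _ x := (imL.hasFDerivAt (x := x)).norm_sq
  have h2 := h1.sqrt (by simpa using hx)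
  have e : (fun y : ℍ[ℝ] => √(‖y.im‖ ^ 2)) = fun y => ‖y.im‖ :=
    funext fun y => Real.sqrt_sq (norm_nonneg _)
  rw [e] at h2
  refine h2.congr_fderiv (ContinuousLinearMap.ext fun h => ?_)
  rw [Real.sqrt_sq (norm_nonneg _)]
  simp [normImDeriv]
  field_simp

theorem hasFDerivAt_toUpper {x : ℍ[ℝ]} (hx : x.im ≠ 0) :
    HasFDerivAt toUpper (reL.smulRight 1 + (normImDeriv x).smulRight Complex.I) x := by
  have h := (reL.hasFDerivAt (x := x)).smul_const (1 : ℂ) |>.add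
    ((hasFDerivAt_norm_im hx).smul_const Complex.I)
  refine h.congr_of_eventuallyEq (Eventually.of_forall fun y => ?_)
  apply Complex.ext <;> simp [toUpper]

theorem hasFDerivAt_unitIm {x : ℍ[ℝ]} (hx : x.im ≠ 0) :
    HasFDerivAt unitIm (‖x.im‖⁻¹ • imL - ((‖x.im‖ ^ 2)⁻¹ • normImDeriv x).smulRight x.im) x := by
  have h := ((hasDerivAt_inv (norm_ne_zero_iff.2 hx)).comp_hasFDerivAt x
    (hasFDerivAt_norm_im hx)).smul (imL.hasFDerivAt (x := x))
  refine h.congr_fderiv (ContinuousLinearMap.ext fun v => ?_)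
  simp [sub_eq_add_neg]

theorem fderiv_apply_eq (u : ℂ → ℍ[ℝ]) (z : ℂ) (a b : ℝ) :
    fderiv ℝ u z (a • 1 + b • Complex.I) = a • dα u z + b • dβ u z := by
  rw [map_add, map_smul, map_smul]; rfl

theorem hasFDerivAt_sliceFun {u v : ℂ → ℍ[ℝ]} {x : ℍ[ℝ]} (hx : x.im ≠ 0)
    (hu : DifferentiableAt ℝ u (toUpper x)) (hv : DifferentiableAt ℝ v (toUpper x)) :
    ∃ A : ℍ[ℝ] →L[ℝ] ℍ[ℝ], HasFDerivAt (sliceFun u v) A x ∧ ∀ h, A h =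
      (h.re • dα u (toUpper x) + normImDeriv x h • dβ u (toUpper x)) +
      (unitIm x * (h.re • dα v (toUpper x) + normImDeriv x h • dβ v (toUpper x)) +
      (‖x.im‖⁻¹ • h.im - ((‖x.im‖ ^ 2)⁻¹ * normImDeriv x h) • x.im) * v (toUpper x)) := by
  refine ⟨_, (hu.hasFDerivAt.comp x (hasFDerivAt_toUpper hx)).add
    ((hasFDerivAt_unitIm hx).mul' (hv.hasFDerivAt.comp x (hasFDerivAt_toUpper hx))), fun h => ?_⟩
  simp [← fderiv_apply_eq, mul_add]
  exact Or.inl rfl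

theorem im_eq_sum (x : ℍ[ℝ]) : x.im = x.imI • qi + x.imJ • qj + x.imK • qk := by
  ext <;> simp

/-- The coefficient `-2/β` of `v` comes from differentiating `Im x / β`: the numerator contributes
`-3/β`, from `i² + j² + k² = -3`, and the denominator `+1/β`. Separating the real from the imaginary
directions serves `∂` and `∂̄` at once. -/
theorem exists_fderiv_sliceFun {u v : ℂ → ℍ[ℝ]} {x : ℍ[ℝ]} (hx : x.im ≠ 0)
    (hu : DifferentiableAt ℝ u (toUpper x)) (hv : DifferentiableAt ℝ v (toUpper x)) :
    ∃ A : ℍ[ℝ] →L[ℝ] ℍ[ℝ], HasFDerivAt (sliceFun u v) A x ∧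
      A 1 = dα u (toUpper x) + unitIm x * dα v (toUpper x) ∧
      qi * A qi + qj * A qj + qk * A qk = unitIm x * dβ u (toUpper x) - dβ v (toUpper x) -
        (2 * ‖x.im‖⁻¹) • v (toUpper x) := by
  obtain ⟨A, hA, hh⟩ := hasFDerivAt_sliceFun hx hu hv
  refine ⟨A, hA, ?_, ?_⟩
  · rw [hh, normImDeriv_apply]; simp
  · have hn : ‖x.im‖ ≠ 0 := norm_ne_zero_iff.2 hx
    have e1 : unitIm x * (unitIm x * dβ v (toUpper x)) = -dβ v (toUpper x) := by
      rw [← mul_assoc, unitIm_mul_unitIm hx, neg_one_mul]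
    have e2 : ((‖x.im‖ ^ 2)⁻¹ * ‖x.im‖⁻¹) • (x.im * (x.im * v (toUpper x))) =
        -(‖x.im‖⁻¹ • v (toUpper x)) := by
      rw [← mul_assoc, im_mul_im, neg_mul, Quaternion.coe_mul_eq_smul, smul_neg, smul_smul]
      congr 2
      field_simp
    have hJ : unitIm x = ‖x.im‖⁻¹ • (x.imI • qi + x.imJ • qj + x.imK • qk) := by
      rw [← im_eq_sum]; rfl
    have ei : qi.im = qi := by ext <;> simp
    have ej : qj.im = qj := by ext <;> simp
    have ek : qk.im = qk := by ext <;> simp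
    have e3 : qi * A qi + qj * A qj + qk * A qk = unitIm x * dβ u (toUpper x) +
        unitIm x * (unitIm x * dβ v (toUpper x)) - (3 * ‖x.im‖⁻¹) • v (toUpper x) -
        ((‖x.im‖ ^ 2)⁻¹ * ‖x.im‖⁻¹) • (x.im * (x.im * v (toUpper x))) := by
      simp only [hh, normImDeriv_apply]
      simp only [re_qi, re_qj, re_qk, imI_qi, imI_qj, imI_qk, imJ_qi, imJ_qj, imJ_qk, imK_qi,
        imK_qj, imK_qk, mul_zero, mul_one, add_zero, zero_add, zero_smul, ei, ej, ek,
        mul_smul_comm]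
      generalize unitIm x * dβ v (toUpper x) = p
      have e4 (s : ℍ[ℝ]) : unitIm x * s =
          ‖x.im‖⁻¹ • (x.imI • (qi * s) + x.imJ • (qj * s) + x.imK • (qk * s)) := by
        rw [hJ]; simp only [add_mul, smul_mul_assoc]
      have e5 (s : ℍ[ℝ]) : x.im * s =
          (x.imI • (qi * s) + x.imJ • (qj * s) + x.imK • (qk * s)) := by
        conv_lhs => rw [im_eq_sum]
        simp only [add_mul, smul_mul_assoc]
      have a1 (s : ℍ[ℝ]) : qi * (qi * s) = -s := by rw [← mul_assoc, qi_mul_qi, neg_one_mul]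
      have a2 (s : ℍ[ℝ]) : qj * (qj * s) = -s := by rw [← mul_assoc, qj_mul_qj, neg_one_mul]
      have a3 (s : ℍ[ℝ]) : qk * (qk * s) = -s := by rw [← mul_assoc, qk_mul_qk, neg_one_mul]
      simp only [sub_mul, smul_mul_assoc]
      generalize hr : x.im * v (toUpper x) = r
      rw [e5 r]
      simp only [e4, mul_add, mul_sub, mul_smul_comm, smul_add, a1, a2, a3]
      module
    rw [e3, e1, e2]
    module

theorem fueter_sliceFun {u v : ℂ → ℍ[ℝ]} {x : ℍ[ℝ]} (hx : x.im ≠ 0)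
    (hu : DifferentiableAt ℝ u (toUpper x)) (hv : DifferentiableAt ℝ v (toUpper x)) :
    fueter (sliceFun u v) x = (2⁻¹ : ℝ) • ((dα u (toUpper x) - dβ v (toUpper x)) +
      unitIm x * (dβ u (toUpper x) + dα v (toUpper x))) - ‖x.im‖⁻¹ • v (toUpper x) := by
  obtain ⟨A, hA, h1, h2⟩ := exists_fderiv_sliceFun hx hu hv
  rw [hA.fueter, add_assoc, add_assoc, ← add_assoc (qi * _), h2, h1, mul_add]
  module

theorem conjFueter_sliceFun {u v : ℂ → ℍ[ℝ]} {x : ℍ[ℝ]} (hx : x.im ≠ 0)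
    (hu : DifferentiableAt ℝ u (toUpper x)) (hv : DifferentiableAt ℝ v (toUpper x)) :
    conjFueter (sliceFun u v) x = (2⁻¹ : ℝ) • ((dα u (toUpper x) + dβ v (toUpper x)) +
      unitIm x * (dα v (toUpper x) - dβ u (toUpper x))) + ‖x.im‖⁻¹ • v (toUpper x) := by
  obtain ⟨A, hA, h1, h2⟩ := exists_fderiv_sliceFun hx hu hv
  rw [hA.conjFueter, sub_sub, sub_sub, ← add_assoc, h2, h1, mul_sub]
  module

end FirstDerivatives

/-! ### Stem functions as quadruples of holomorphic functions -/

section Stems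

/-- The coordinates of a quaternion. -/
def coordL (l : Fin 4) : ℍ[ℝ] →L[ℝ] ℝ := innerSL ℝ (quaternionBasis l)

theorem sum_coordL (q : ℍ[ℝ]) : ∑ l, coordL l q • quaternionBasis l = q :=
  quaternionBasis.sum_repr' q

/-- The real component of the stem function with complex-valued coordinates `h`. -/
def stemOfRe (h : Fin 4 → ℂ → ℂ) (z : ℂ) : ℍ[ℝ] := ∑ l, (h l z).re • quaternionBasis l

/-- The imaginary component of the stem function with complex-valued coordinates `h`. -/
def stemOfIm (h : Fin 4 → ℂ → ℂ) (z : ℂ) : ℍ[ℝ] := ∑ l, (h l z).im • quaternionBasis l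

/-- The complex-valued coordinates of a stem function. -/
def stemCoord (F₁ F₂ : ℂ → ℍ[ℝ]) (l : Fin 4) (z : ℂ) : ℂ := ⟨coordL l (F₁ z), coordL l (F₂ z)⟩

theorem stemOfRe_stemCoord (F₁ F₂ : ℂ → ℍ[ℝ]) : stemOfRe (stemCoord F₁ F₂) = F₁ :=
  funext fun z => sum_coordL (F₁ z)

theorem stemOfIm_stemCoord (F₁ F₂ : ℂ → ℍ[ℝ]) : stemOfIm (stemCoord F₁ F₂) = F₂ :=
  funext fun z => sum_coordL (F₂ z)

variable {D : Set ℂ} {F₁ F₂ : ℂ → ℍ[ℝ]} {h : Fin 4 → ℂ → ℂ} {z : ℂ}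

theorem hasFDerivAt_stemOf (L : ℂ →L[ℝ] ℝ) (hh : ∀ l, DifferentiableAt ℂ (h l) z) :
    ∃ A : ℂ →L[ℝ] ℍ[ℝ], HasFDerivAt (fun w => ∑ l, L (h l w) • quaternionBasis l) A z ∧
      ∀ c, A c = ∑ l, L (c * deriv (h l) z) • quaternionBasis l := by
  have h1 (l : Fin 4) : HasFDerivAt (fun w => L (h l w) • quaternionBasis l) _ z :=
    (L.hasFDerivAt.comp z ((hh l).hasDerivAt.hasFDerivAt.restrictScalars ℝ)).smul_const
      (quaternionBasis l)
  refine ⟨_, HasFDerivAt.fun_sum fun l _ => h1 l, fun c => ?_⟩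
  simp

theorem hasFDerivAt_stemOfRe (hh : ∀ l, DifferentiableAt ℂ (h l) z) :
    ∃ A : ℂ →L[ℝ] ℍ[ℝ], HasFDerivAt (stemOfRe h) A z ∧
      ∀ c, A c = ∑ l, (c * deriv (h l) z).re • quaternionBasis l :=
  hasFDerivAt_stemOf Complex.reCLM hh

theorem hasFDerivAt_stemOfIm (hh : ∀ l, DifferentiableAt ℂ (h l) z) :
    ∃ A : ℂ →L[ℝ] ℍ[ℝ], HasFDerivAt (stemOfIm h) A z ∧
      ∀ c, A c = ∑ l, (c * deriv (h l) z).im • quaternionBasis l :=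
  hasFDerivAt_stemOf Complex.imCLM hh

theorem dα_stemOfRe (hh : ∀ l, DifferentiableAt ℂ (h l) z) :
    dα (stemOfRe h) z = stemOfRe (fun l => deriv (h l)) z := by
  obtain ⟨A, hA, hc⟩ := hasFDerivAt_stemOfRe hh
  rw [dα, hA.fderiv, hc]; simp [stemOfRe]

theorem dα_stemOfIm (hh : ∀ l, DifferentiableAt ℂ (h l) z) :
    dα (stemOfIm h) z = stemOfIm (fun l => deriv (h l)) z := by
  obtain ⟨A, hA, hc⟩ := hasFDerivAt_stemOfIm hh
  rw [dα, hA.fderiv, hc]; simp [stemOfIm]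

theorem dβ_stemOfRe (hh : ∀ l, DifferentiableAt ℂ (h l) z) :
    dβ (stemOfRe h) z = -stemOfIm (fun l => deriv (h l)) z := by
  obtain ⟨A, hA, hc⟩ := hasFDerivAt_stemOfRe hh
  rw [dβ, hA.fderiv, hc]; simp [stemOfIm]

theorem dβ_stemOfIm (hh : ∀ l, DifferentiableAt ℂ (h l) z) :
    dβ (stemOfIm h) z = stemOfRe (fun l => deriv (h l)) z := by
  obtain ⟨A, hA, hc⟩ := hasFDerivAt_stemOfIm hh
  rw [dβ, hA.fderiv, hc]; simp [stemOfRe]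

theorem holomorphicStem_stemOf (hh : ∀ z ∈ D, ∀ l, DifferentiableAt ℂ (h l) z) :
    HolomorphicStem D (stemOfRe h) (stemOfIm h) := fun z hz => by
  obtain ⟨A, hA, -⟩ := hasFDerivAt_stemOfRe (hh z hz)
  obtain ⟨B, hB, -⟩ := hasFDerivAt_stemOfIm (hh z hz)
  refine ⟨hA.differentiableAt, hB.differentiableAt, ?_, ?_⟩
  · rw [dα_stemOfRe (hh z hz), dβ_stemOfIm (hh z hz)]
  · rw [dα_stemOfIm (hh z hz), dβ_stemOfRe (hh z hz)]

theorem isStem_stemOf (hh : ∀ z ∈ D, ∀ l, h l (conj z) = conj (h l z)) :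
    IsStem D (stemOfRe h) (stemOfIm h) := fun z hz => by
  constructor
  · simp [stemOfRe, hh z hz]
  · simp [stemOfIm, hh z hz]

/-- In each real coordinate of `ℍ` the stem equations are the classical Cauchy–Riemann equations.
This makes analyticity and complex derivatives in one variable available for stems. -/
theorem HolomorphicStem.differentiableAt_stemCoord (hF : HolomorphicStem D F₁ F₂) (hz : z ∈ D)
    (l : Fin 4) : DifferentiableAt ℂ (stemCoord F₁ F₂ l) z := by
  obtain ⟨h1, h2, h3, h4⟩ := hF z hz
  have e : stemCoord F₁ F₂ l = fun w => (coordL l (F₁ w) : ℂ) + (coordL l (F₂ w) : ℂ) * Complex.I :=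
    funext fun w => by apply Complex.ext <;> simp [stemCoord]
  have hd := ((Complex.ofRealCLM.comp (coordL l)).hasFDerivAt.comp z h1.hasFDerivAt).add
    (((Complex.ofRealCLM.comp (coordL l)).hasFDerivAt.comp z h2.hasFDerivAt).mul_const Complex.I)
  replace hd := hd.congr_of_eventuallyEq (f₁ := stemCoord F₁ F₂ l) (Eventually.of_forall (congrFun e))
  rw [differentiableAt_complex_iff_differentiableAt_real]
  refine ⟨hd.differentiableAt, ?_⟩
  rw [hd.fderiv]
  simp only [dα, dβ] at h3 h4
  apply Complex.ext <;> simp [h3, h4]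

theorem IsStem.stemCoord_conj (hF : IsStem D F₁ F₂) (hz : z ∈ D) (l : Fin 4) :
    stemCoord F₁ F₂ l (conj z) = conj (stemCoord F₁ F₂ l z) := by
  obtain ⟨h1, h2⟩ := hF z hz
  apply Complex.ext <;> simp [stemCoord, h1, h2]

theorem dα_congr {F G : ℂ → ℍ[ℝ]} (hFG : F =ᶠ[𝓝 z] G) : dα F z = dα G z := by
  rw [dα, dα, hFG.fderiv_eq]

theorem dβ_congr {F G : ℂ → ℍ[ℝ]} (hFG : F =ᶠ[𝓝 z] G) : dβ F z = dβ G z := by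
  rw [dβ, dβ, hFG.fderiv_eq]

theorem HolomorphicStem.congr {G₁ G₂ : ℂ → ℍ[ℝ]} (hF : HolomorphicStem D F₁ F₂) (hD : IsOpen D)
    (h1 : ∀ z ∈ D, G₁ z = F₁ z) (h2 : ∀ z ∈ D, G₂ z = F₂ z) : HolomorphicStem D G₁ G₂ :=
  fun z hz => by
  have e1 : G₁ =ᶠ[𝓝 z] F₁ := eventually_of_mem (hD.mem_nhds hz) h1
  have e2 : G₂ =ᶠ[𝓝 z] F₂ := eventually_of_mem (hD.mem_nhds hz) h2
  rw [dα_congr e1, dα_congr e2, dβ_congr e1, dβ_congr e2, e1.differentiableAt_iff,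
    e2.differentiableAt_iff]
  exact hF z hz

theorem IsStem.congr {G₁ G₂ : ℂ → ℍ[ℝ]} (hF : IsStem D F₁ F₂) (hconj : ∀ z ∈ D, conj z ∈ D)
    (h1 : ∀ z ∈ D, G₁ z = F₁ z) (h2 : ∀ z ∈ D, G₂ z = F₂ z) : IsStem D G₁ G₂ := fun z hz => by
  rw [h1 z hz, h2 z hz, h1 _ (hconj z hz), h2 _ (hconj z hz)]
  exact hF z hz

theorem HolomorphicStem.analyticAt_stemCoord (hF : HolomorphicStem D F₁ F₂) (hD : IsOpen D)
    (hz : z ∈ D) (l : Fin 4) : AnalyticAt ℂ (stemCoord F₁ F₂ l) z :=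
  DifferentiableOn.analyticAt (s := D)
    (fun _ hw => (hF.differentiableAt_stemCoord hw l).differentiableWithinAt) (hD.mem_nhds hz)

theorem HolomorphicStem.dα_eq (hF : HolomorphicStem D F₁ F₂) (hz : z ∈ D) :
    dα F₁ z = stemOfRe (fun l => deriv (stemCoord F₁ F₂ l)) z ∧
    dα F₂ z = stemOfIm (fun l => deriv (stemCoord F₁ F₂ l)) z := by
  have hd := fun l => hF.differentiableAt_stemCoord hz l
  rw [← dα_stemOfRe hd, ← dα_stemOfIm hd, stemOfRe_stemCoord, stemOfIm_stemCoord]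
  exact ⟨rfl, rfl⟩

theorem HolomorphicStem.deriv (hF : HolomorphicStem D F₁ F₂) (hD : IsOpen D) :
    HolomorphicStem D (dα F₁) (dα F₂) :=
  (holomorphicStem_stemOf fun _ hz l =>
    (hF.analyticAt_stemCoord hD hz l).deriv.differentiableAt).congr hD
    (fun _ hz => (hF.dα_eq hz).1) (fun _ hz => (hF.dα_eq hz).2)

theorem IsStem.deriv (hs : IsStem D F₁ F₂) (hF : HolomorphicStem D F₁ F₂) (hD : IsOpen D)
    (hconj : ∀ z ∈ D, conj z ∈ D) : IsStem D (dα F₁) (dα F₂) := by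
  refine (isStem_stemOf (h := fun l => _root_.deriv (stemCoord F₁ F₂ l)) fun z hz l => ?_).congr
    hconj (fun _ hz => (hF.dα_eq hz).1) (fun _ hz => (hF.dα_eq hz).2)
  -- Each coordinate equals `conj ∘ h ∘ conj` near the conjugate point, so its derivative inherits
  -- the symmetry.
  have h1 := (hF.differentiableAt_stemCoord hz l).hasDerivAt.conj_conj
  refine (h1.congr_of_eventuallyEq ?_).deriv
  refine eventually_of_mem (hD.mem_nhds (hconj z hz)) fun w hw => ?_
  have := hs.stemCoord_conj hw l
  simp [this]

theorem HolomorphicStem.contDiffAt {n : WithTop ℕ∞} (hF : HolomorphicStem D F₁ F₂) (hD : IsOpen D)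
    (hz : z ∈ D) : ContDiffAt ℝ n F₁ z ∧ ContDiffAt ℝ n F₂ z := by
  have h1 (l : Fin 4) : ContDiffAt ℝ n (stemCoord F₁ F₂ l) z :=
    (hF.analyticAt_stemCoord hD hz l).contDiffAt.restrict_scalars ℝ
  constructor
  · rw [← stemOfRe_stemCoord F₁ F₂]
    exact ContDiffAt.sum fun l _ =>
      (Complex.reCLM.contDiff.contDiffAt.comp z (h1 l)).smul contDiffAt_const
  · rw [← stemOfIm_stemCoord F₁ F₂]
    exact ContDiffAt.sum fun l _ =>
      (Complex.imCLM.contDiff.contDiffAt.comp z (h1 l)).smul contDiffAt_const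

/-- For a holomorphic stem `½(∂_α - i∂_β)F = ∂_α F`. The recovered stem agrees with `F` only on `D`,
which suffices for derivatives because `D` is open. -/
theorem sliceDeriv_stem (hF : HolomorphicStem D F₁ F₂) (hD : IsOpen D) {g : ℍ[ℝ] → ℍ[ℝ]}
    (hg : Induces D F₁ F₂ g) (hz : z ∈ D) :
    (2⁻¹ : ℝ) • (dα (stemRe g) z + dβ (stemIm g) z) = dα F₁ z ∧
    (2⁻¹ : ℝ) • (dα (stemIm g) z - dβ (stemRe g) z) = dα F₂ z := by
  have e1 : stemRe g =ᶠ[𝓝 z] F₁ :=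
    eventually_of_mem (hD.mem_nhds hz) fun w hw => (hg.stem_eq hw).1
  have e2 : stemIm g =ᶠ[𝓝 z] F₂ :=
    eventually_of_mem (hD.mem_nhds hz) fun w hw => (hg.stem_eq hw).2
  obtain ⟨-, -, h3, h4⟩ := hF z hz
  rw [dα_congr e1, dα_congr e2, dβ_congr e1, dβ_congr e2, ← h3, h4]
  constructor <;> module

/-- The slice derivative is induced by the derivative of the stem function. -/
theorem induces_sliceDeriv (hD : IsOpen D) (hconj : ∀ z ∈ D, conj z ∈ D) (hs : IsStem D F₁ F₂)
    (hF : HolomorphicStem D F₁ F₂) {g : ℍ[ℝ] → ℍ[ℝ]} (hg : Induces D F₁ F₂ g) :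
    Induces D (dα F₁) (dα F₂) (sliceDeriv g) := by
  have h1 := (hs.deriv hF hD hconj).congr hconj (fun _ hz => (sliceDeriv_stem hF hD hg hz).1)
    (fun _ hz => (sliceDeriv_stem hF hD hg hz).2)
  intro z hz J hJ
  rw [← (sliceDeriv_stem hF hD hg hz).1, ← (sliceDeriv_stem hF hD hg hz).2]
  exact h1.sliceFun z hz J hJ

theorem sliceDeriv_mem_SR (hD : IsOpen D) (hconj : ∀ z ∈ D, conj z ∈ D) {g : ℍ[ℝ] → ℍ[ℝ]}
    (hg : g ∈ SR D) : sliceDeriv g ∈ SR D := by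
  obtain ⟨F₁, F₂, hs, hF, hi⟩ := hg
  exact ⟨_, _, hs.deriv hF hD hconj, hF.deriv hD, induces_sliceDeriv hD hconj hs hF hi⟩

end Stems

/-! ### Smoothness of slice-regular functions, including at real points -/

section Smoothness

/-- The embedding of `ℂ` into the quaternions determined by an imaginary unit. -/
def unitHom {J : ℍ[ℝ]} (hJ : J * J = -1) : ℂ →ₐ[ℝ] ℍ[ℝ] := Complex.liftAux J hJ

theorem unitHom_apply {J : ℍ[ℝ]} (hJ : J * J = -1) (z : ℂ) :
    unitHom hJ z = (z.re : ℍ[ℝ]) + J * (z.im : ℍ[ℝ]) := by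
  rw [unitHom, Complex.liftAux_apply, ← Quaternion.coe_commutes, Quaternion.coe_mul_eq_smul]
  rfl

theorem continuous_unitHom {J : ℍ[ℝ]} (hJ : J * J = -1) : Continuous (unitHom hJ) :=
  (unitHom hJ).toLinearMap.continuous_of_finiteDimensional

/-- Transports complex power series to the slice of `J`: `unitHom hJ` is an algebra map, and the
constant quaternions stand on the right. -/
theorem stemOf_slice (h : Fin 4 → ℂ → ℂ) (z : ℂ) {J : ℍ[ℝ]} (hJ : J * J = -1) :
    stemOfRe h z + J * stemOfIm h z = ∑ l, unitHom hJ (h l z) * quaternionBasis l := by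
  simp only [stemOfRe, stemOfIm, Finset.mul_sum, ← Finset.sum_add_distrib, unitHom_apply, add_mul,
    Quaternion.coe_mul_eq_smul, mul_assoc]

/-- An analytic function which commutes with the conjugation near a real point has a power series
with real coefficients there, hence extends to an analytic function of a quaternion variable. -/
theorem exists_analyticAt_extension {h : ℂ → ℂ} {t : ℝ} (hh : AnalyticAt ℂ h t)
    (hc : ∀ᶠ z in 𝓝 (t : ℂ), h (conj z) = conj (h z)) :
    ∃ q : ℍ[ℝ] → ℍ[ℝ], AnalyticAt ℝ q (t : ℍ[ℝ]) ∧ ∀ᶠ z in 𝓝 (t : ℂ), ∀ J : ℍ[ℝ],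
      ∀ hJ : J * J = -1, q (unitHom hJ z) = unitHom hJ (h z) := by
  obtain ⟨p, r, hp⟩ := hh
  let c : ℕ → ℝ := fun n => (p.coeff n).re
  have hrad : p.radius ≤ (FormalMultilinearSeries.ofScalars ℍ[ℝ] c).radius := by
    refine FormalMultilinearSeries.radius_le_of_le fun n => ?_
    rw [FormalMultilinearSeries.ofScalars_norm, Real.norm_eq_abs,
      FormalMultilinearSeries.norm_apply_eq_norm_coef]
    exact Complex.abs_re_le_norm _
  have hpos := (hp.r_pos.trans_le hp.r_le).trans_le hrad
  have hq := (FormalMultilinearSeries.ofScalars ℍ[ℝ] c).hasFPowerSeriesOnBall hpos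
  refine ⟨fun x => (FormalMultilinearSeries.ofScalars ℍ[ℝ] c).sum (x - t), ?_, ?_⟩
  · have := hq.comp_sub (t : ℍ[ℝ])
    rw [zero_add] at this
    exact this.analyticAt
  · have hb : ∀ᶠ z in 𝓝 (t : ℂ), z ∈ Metric.eball (t : ℂ) r := Metric.eball_mem_nhds _ hp.r_pos
    have hb' : ∀ᶠ z in 𝓝 (t : ℂ), conj z ∈ Metric.eball (t : ℂ) r := by
      have : Tendsto (fun z : ℂ => conj z) (𝓝 (t : ℂ)) (𝓝 (t : ℂ)) := by
        have := Complex.continuous_conj.tendsto (t : ℂ)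
        rwa [Complex.conj_ofReal] at this
      exact this hb
    filter_upwards [hb, hb', hc] with z hz hz' hcz J hJ
    have h1 (w : ℂ) (hw : w ∈ Metric.eball (t : ℂ) r) :
        HasSum (fun n => (w - t) ^ n * p.coeff n) (h w) := by
      simpa [FormalMultilinearSeries.apply_eq_pow_smul_coeff] using hp.hasSum_sub hw
    have h2 := (h1 _ hz').map (starRingEnd ℂ) Complex.continuous_conj
    rw [hcz, Complex.conj_conj] at h2
    -- Averaging the series of `h z` with the conjugated series at `conj z` replaces each
    -- coefficient by its real part, so the coefficients need not be shown real beforehand.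
    have h3 : HasSum (fun n => (z - t) ^ n * (c n : ℂ)) (h z) := by
      have := ((h1 z hz).add h2).mul_left (2⁻¹ : ℂ)
      rw [← two_mul, inv_mul_cancel_left₀ two_ne_zero] at this
      refine this.congr_fun fun n => ?_
      simp only [Function.comp, map_mul, map_pow, map_sub, Complex.conj_conj, Complex.conj_ofReal]
      rw [← mul_add, Complex.add_conj]
      push_cast; ring
    have h4 := h3.map (unitHom hJ) (continuous_unitHom hJ)
    rw [← h4.tsum_eq]
    change FormalMultilinearSeries.ofScalarsSum c _ = _
    rw [FormalMultilinearSeries.ofScalars_sum_eq]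
    congr 1
    funext n
    have ht (s : ℝ) : unitHom hJ (s : ℂ) = (s : ℍ[ℝ]) := by simp
    simp only [Function.comp, map_mul, map_pow, map_sub, ht]
    rw [← Quaternion.coe_commutes, Quaternion.coe_mul_eq_smul]

variable {D : Set ℂ} {F₁ F₂ : ℂ → ℍ[ℝ]} {x : ℍ[ℝ]}

theorem contDiffAt_toUpper {n : WithTop ℕ∞} (hx : x.im ≠ 0) : ContDiffAt ℝ n toUpper x := by
  have h1 : ContDiffAt ℝ n (fun y : ℍ[ℝ] => ‖y.im‖) x := imL.contDiff.contDiffAt.norm ℝ hx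
  have h2 := ((reL.contDiff (n := n)).contDiffAt (x := x)).smul (contDiffAt_const (c := (1 : ℂ)))
    |>.add (h1.smul (contDiffAt_const (c := Complex.I)))
  refine h2.congr_of_eventuallyEq (Eventually.of_forall fun y => ?_)
  apply Complex.ext <;> simp [toUpper]

theorem contDiffAt_unitIm {n : WithTop ℕ∞} (hx : x.im ≠ 0) : ContDiffAt ℝ n unitIm x := by
  have h1 : ContDiffAt ℝ n (fun y : ℍ[ℝ] => ‖y.im‖) x := imL.contDiff.contDiffAt.norm ℝ hx
  exact (h1.inv (norm_ne_zero_iff.2 hx)).smul imL.contDiff.contDiffAt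

theorem eventually_im_ne_zero (hx : x.im ≠ 0) : ∀ᶠ y in 𝓝 x, y.im ≠ 0 :=
  Quaternion.continuous_im.continuousAt.eventually_ne hx

theorem toUpper_of_im_eq_zero (hx : x.im = 0) : toUpper x = (x.re : ℂ) := by
  apply Complex.ext <;> simp [toUpper, hx]

theorem Induces.contDiffAt {n : WithTop ℕ∞} {g : ℍ[ℝ] → ℍ[ℝ]} (hg : Induces D F₁ F₂ g)
    (hs : IsStem D F₁ F₂) (hF : HolomorphicStem D F₁ F₂) (hD : IsOpen D)
    (hconj : ∀ z ∈ D, conj z ∈ D) (hx : x ∈ axial D) : ContDiffAt ℝ n g x := by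
  have hxD : toUpper x ∈ D := (mem_axial hconj).1 hx
  -- `‖Im x‖` is not smooth at real points, so there `g` is identified with a combination of
  -- quaternionic analytic functions; elsewhere it is a composition of smooth maps.
  by_cases h0 : x.im = 0
  · have hx' : x = (x.re : ℍ[ℝ]) := by
      conv_lhs => rw [← Quaternion.re_add_im x, h0, add_zero]
    have hu := toUpper_of_im_eq_zero h0
    rw [hu] at hxD
    have := fun l => exists_analyticAt_extension (t := x.re) (hF.analyticAt_stemCoord hD hxD l)
      (eventually_of_mem (hD.mem_nhds hxD) fun w hw => hs.stemCoord_conj hw l)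
    choose q hq hqz using this
    rw [hx']
    have hsum : ContDiffAt ℝ n (fun y => ∑ l, q l y * quaternionBasis l) (x.re : ℍ[ℝ]) :=
      ContDiffAt.sum fun l _ => (hq l).contDiffAt.mul contDiffAt_const
    refine hsum.congr_of_eventuallyEq ?_
    rw [← hx']
    have h1 : ∀ᶠ z in 𝓝 (x.re : ℂ), z ∈ D ∧ ∀ l, ∀ J : ℍ[ℝ], ∀ hJ : J * J = -1,
        q l (unitHom hJ z) = unitHom hJ (stemCoord F₁ F₂ l z) :=
      (hD.eventually_mem hxD).and (eventually_all.2 hqz)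
    have h2 : Tendsto toUpper (𝓝 x) (𝓝 (x.re : ℂ)) := by
      rw [← hu]; exact continuous_toUpper.continuousAt
    filter_upwards [h2.eventually h1] with y hy
    -- The unit varies with `y`; this is why the extension property holds for all units on one
    -- common neighbourhood.
    obtain ⟨J, hJ, hJy, -⟩ := exists_unit y
    have h3 := hg _ hy.1 J hJ
    rw [hJy] at h3
    rw [h3]
    conv_lhs => rw [← stemOfRe_stemCoord F₁ F₂]
    conv_lhs =>
      enter [2, 2]
      rw [← stemOfIm_stemCoord F₁ F₂]
    rw [stemOf_slice _ _ hJ]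
    refine Finset.sum_congr rfl fun l _ => ?_
    rw [← hy.2 l J hJ, unitHom_apply, hJy]
  · have h1 : g =ᶠ[𝓝 x] sliceFun F₁ F₂ :=
      eventually_of_mem ((isOpen_axial hD hconj).mem_nhds hx) fun y hy => hg.eq_sliceFun hs hy
    refine ContDiffAt.congr_of_eventuallyEq ?_ h1
    obtain ⟨c1, c2⟩ := hF.contDiffAt (n := n) hD hxD
    exact (c1.comp x (contDiffAt_toUpper h0)).add
      ((contDiffAt_unitIm h0).mul (c2.comp x (contDiffAt_toUpper h0)))

/-- Slice-regular functions are smooth. -/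
theorem contDiffAt_of_mem_SR {n : WithTop ℕ∞} {g : ℍ[ℝ] → ℍ[ℝ]} (hg : g ∈ SR D) (hD : IsOpen D)
    (hconj : ∀ z ∈ D, conj z ∈ D) (hx : x ∈ axial D) : ContDiffAt ℝ n g x := by
  obtain ⟨F₁, F₂, hs, hF, hi⟩ := hg
  exact hi.contDiffAt hs hF hD hconj hx

end Smoothness

/-! ### Harmonicity of the spherical derivative and the Laplacian of slice-regular functions -/

section SliceLaplacian

variable {D : Set ℂ} {F₁ F₂ : ℂ → ℍ[ℝ]} {x : ℍ[ℝ]} {z : ℂ} {g : ℍ[ℝ] → ℍ[ℝ]}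

/-- The spherical derivative `z ↦ F₂(z) / Im z` on the level of stem functions. -/
def divIm (F : ℂ → ℍ[ℝ]) (z : ℂ) : ℍ[ℝ] := z.im⁻¹ • F z

theorem hasFDerivAt_divIm {F : ℂ → ℍ[ℝ]} (hz : z.im ≠ 0) (hF : DifferentiableAt ℝ F z) :
    HasFDerivAt (divIm F) (z.im⁻¹ • fderiv ℝ F z +
      ((-(z.im ^ 2)⁻¹) • Complex.imCLM).smulRight (F z)) z :=
  ((hasDerivAt_inv hz).comp_hasFDerivAt z Complex.imCLM.hasFDerivAt).smul hF.hasFDerivAt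

theorem dα_divIm {F : ℂ → ℍ[ℝ]} (hz : z.im ≠ 0) (hF : DifferentiableAt ℝ F z) :
    dα (divIm F) z = z.im⁻¹ • dα F z := by
  rw [dα, (hasFDerivAt_divIm hz hF).fderiv]; simp [dα]

theorem dβ_divIm {F : ℂ → ℍ[ℝ]} (hz : z.im ≠ 0) (hF : DifferentiableAt ℝ F z) :
    dβ (divIm F) z = z.im⁻¹ • (dβ F z - divIm F z) := by
  rw [dβ, (hasFDerivAt_divIm hz hF).fderiv]
  simp [dβ, divIm, smul_smul, sub_eq_add_neg, sq]

theorem contDiffAt_divIm {n : WithTop ℕ∞} {F : ℂ → ℍ[ℝ]} (hz : z.im ≠ 0)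
    (hF : ContDiffAt ℝ n F z) : ContDiffAt ℝ n (divIm F) z :=
  (Complex.imCLM.contDiff.contDiffAt.inv hz).smul hF

theorem dα_sub {F G : ℂ → ℍ[ℝ]} (hF : DifferentiableAt ℝ F z) (hG : DifferentiableAt ℝ G z) :
    dα (F - G) z = dα F z - dα G z := by
  rw [dα, fderiv_sub hF hG]; rfl

theorem dβ_sub {F G : ℂ → ℍ[ℝ]} (hF : DifferentiableAt ℝ F z) (hG : DifferentiableAt ℝ G z) :
    dβ (F - G) z = dβ F z - dβ G z := by
  rw [dβ, fderiv_sub hF hG]; rfl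

theorem eventually_im_ne_zero' (hz : z.im ≠ 0) : ∀ᶠ w in 𝓝 z, w.im ≠ 0 :=
  Complex.continuous_im.continuousAt.eventually_ne hz

theorem HolomorphicStem.eventually_derivs_divIm (hF : HolomorphicStem D F₁ F₂) (hD : IsOpen D)
    (hz : z ∈ D) (hi : z.im ≠ 0) :
    dα (divIm F₂) =ᶠ[𝓝 z] divIm (dα F₂) ∧ dβ (divIm F₂) =ᶠ[𝓝 z] divIm (dα F₁ - divIm F₂) := by
  constructor
  · filter_upwards [eventually_im_ne_zero' hi, hD.mem_nhds hz] with w hw hwD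
    exact dα_divIm hw (hF w hwD).2.1
  · filter_upwards [eventually_im_ne_zero' hi, hD.mem_nhds hz] with w hw hwD
    rw [dβ_divIm hw (hF w hwD).2.1, ← (hF w hwD).2.2.1]; rfl

/-- The first identity is the equation `w_αα + w_ββ + (2/β) w_β = 0` of axially symmetric harmonic
functions on `ℝ⁴`, for `w = F₂/β`. It follows from `w_α = ∂_αF₂/β` and `w_β = (∂_αF₁ - w)/β`,
differentiated once more. -/
theorem HolomorphicStem.second_derivs_divIm (hF : HolomorphicStem D F₁ F₂) (hD : IsOpen D)
    (hz : z ∈ D) (hi : z.im ≠ 0) :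
    dα (dα (divIm F₂)) z + dβ (dβ (divIm F₂)) z = -((2 * z.im⁻¹) • dβ (divIm F₂) z) ∧
    dα (dβ (divIm F₂)) z = dβ (dα (divIm F₂)) z := by
  obtain ⟨e1, e2⟩ := hF.eventually_derivs_divIm hD hz hi
  obtain ⟨d1, d2, d3, d4⟩ := hF.deriv hD z hz
  have d0 : DifferentiableAt ℝ (divIm F₂) z :=
    (hasFDerivAt_divIm hi (hF z hz).2.1).differentiableAt
  rw [dα_congr e1, dα_congr e2, dβ_congr e1, dβ_congr e2, dα_divIm hi d2, dβ_divIm hi d2,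
    dα_divIm hi (d1.sub d0), dβ_divIm hi (d1.sub d0), dα_sub d1 d0, dβ_sub d1 d0, e1.eq_of_nhds,
    e2.eq_of_nhds, d3, d4]
  constructor
  · simp only [divIm]; module
  · rfl

theorem sliceFun_zero_right (w : ℂ → ℍ[ℝ]) : sliceFun w 0 = w ∘ toUpper := by
  funext y; simp [sliceFun_apply]

theorem toUpper_im_ne_zero (hx : x.im ≠ 0) : (toUpper x).im ≠ 0 := norm_ne_zero_iff.2 hx

theorem contDiffAt_comp_toUpper {n : WithTop ℕ∞} {w : ℂ → ℍ[ℝ]} (hx : x.im ≠ 0)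
    (hw : ContDiffAt ℝ n w (toUpper x)) : ContDiffAt ℝ n (w ∘ toUpper) x :=
  hw.comp x (contDiffAt_toUpper hx)

theorem fueter_comp_toUpper {w : ℂ → ℍ[ℝ]} (hx : x.im ≠ 0)
    (hw : DifferentiableAt ℝ w (toUpper x)) :
    fueter (w ∘ toUpper) x = ((2⁻¹ : ℝ) • sliceFun (dα w) (dβ w)) x := by
  have h0 : DifferentiableAt ℝ (0 : ℂ → ℍ[ℝ]) (toUpper x) := differentiableAt_const _
  rw [← sliceFun_zero_right, fueter_sliceFun hx hw h0]
  simp [dα, dβ, sliceFun_apply]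

theorem conjFueter_comp_toUpper {w : ℂ → ℍ[ℝ]} (hx : x.im ≠ 0)
    (hw : DifferentiableAt ℝ w (toUpper x)) :
    conjFueter (w ∘ toUpper) x = (2⁻¹ : ℝ) • (dα w (toUpper x) - unitIm x * dβ w (toUpper x)) := by
  have h0 : DifferentiableAt ℝ (0 : ℂ → ℍ[ℝ]) (toUpper x) := differentiableAt_const _
  rw [← sliceFun_zero_right, conjFueter_sliceFun hx hw h0]
  simp [dα, dβ, sub_eq_add_neg]

/-- The spherical derivative of a slice-regular function is harmonic off the real axis. -/
theorem laplacian_divIm (hF : HolomorphicStem D F₁ F₂) (hD : IsOpen D) (hxD : toUpper x ∈ D)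
    (hx : x.im ≠ 0) : Δ (divIm F₂ ∘ toUpper) x = 0 := by
  have hi := toUpper_im_ne_zero hx
  have hc : ContDiffAt ℝ 2 (divIm F₂) (toUpper x) :=
    contDiffAt_divIm hi (hF.contDiffAt hD hxD).2
  rw [laplacian_eq_conjFueter_fueter (contDiffAt_comp_toUpper hx hc)]
  have h1 : fueter (divIm F₂ ∘ toUpper) =ᶠ[𝓝 x]
      (2⁻¹ : ℝ) • sliceFun (dα (divIm F₂)) (dβ (divIm F₂)) := by
    filter_upwards [eventually_im_ne_zero hx,
      continuous_toUpper.continuousAt (hD.mem_nhds hxD)] with y hy hyD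
    exact fueter_comp_toUpper hy
      (hasFDerivAt_divIm (toUpper_im_ne_zero hy) (hF _ hyD).2.1).differentiableAt
  have c1 : DifferentiableAt ℝ (dα (divIm F₂)) (toUpper x) :=
    ((hc.fderiv_right (m := 1) (by norm_num)).clm_apply contDiffAt_const).differentiableAt
      one_ne_zero
  have c2 : DifferentiableAt ℝ (dβ (divIm F₂)) (toUpper x) :=
    ((hc.fderiv_right (m := 1) (by norm_num)).clm_apply contDiffAt_const).differentiableAt
      one_ne_zero
  obtain ⟨s1, s2⟩ := hF.second_derivs_divIm hD hxD hi
  -- `∂w` is half the slice function with components `w_α, w_β`, so the first-order formula applies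
  -- again; its term `w_β/β` cancels `½(w_αα + w_ββ)`.
  rw [conjFueter_congr h1, conjFueter_const_smul, conjFueter_sliceFun hx c1 c2, s1, s2, sub_self,
    mul_zero, add_zero]
  change (4 : ℝ) • (2⁻¹ : ℝ) • ((2⁻¹ : ℝ) • -((2 * ‖x.im‖⁻¹) • dβ (divIm F₂) (toUpper x)) +
    ‖x.im‖⁻¹ • dβ (divIm F₂) (toUpper x)) = 0
  module

theorem fueter_slice
    (hD : IsOpen D) (hconj : ∀ z ∈ D, conj z ∈ D) (hs : IsStem D F₁ F₂)
    (hF : HolomorphicStem D F₁ F₂) (hg : Induces D F₁ F₂ g) (hxD : x ∈ axial D) (hx : x.im ≠ 0) :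
    fueter g x = (-(divIm F₂ ∘ toUpper)) x := by
  have h1 : g =ᶠ[𝓝 x] sliceFun F₁ F₂ :=
    eventually_of_mem ((isOpen_axial hD hconj).mem_nhds hxD) fun y hy => hg.eq_sliceFun hs hy
  obtain ⟨d1, d2, d3, d4⟩ := hF _ ((mem_axial hconj).1 hxD)
  rw [fueter_congr h1, fueter_sliceFun hx d1 d2, d3, d4, sub_self, neg_add_cancel, mul_zero,
    add_zero, smul_zero, zero_sub]
  rfl

theorem conjFueter_slice
    (hD : IsOpen D) (hconj : ∀ z ∈ D, conj z ∈ D) (hs : IsStem D F₁ F₂)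
    (hF : HolomorphicStem D F₁ F₂) (hg : Induces D F₁ F₂ g) (hxD : x ∈ axial D) (hx : x.im ≠ 0) :
    conjFueter g x = (sliceDeriv g + divIm F₂ ∘ toUpper) x := by
  have h1 : g =ᶠ[𝓝 x] sliceFun F₁ F₂ :=
    eventually_of_mem ((isOpen_axial hD hconj).mem_nhds hxD) fun y hy => hg.eq_sliceFun hs hy
  obtain ⟨d1, d2, d3, d4⟩ := hF _ ((mem_axial hconj).1 hxD)
  rw [Pi.add_apply, (induces_sliceDeriv hD hconj hs hF hg).eq_sliceFun (hs.deriv hF hD hconj) hxD,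
    conjFueter_congr h1, conjFueter_sliceFun hx d1 d2, ← d3, d4, sliceFun_apply]
  congr 1
  rw [sub_neg_eq_add, ← two_smul ℝ, ← two_smul ℝ, mul_smul_comm]
  module

theorem eventually_axial_im_ne_zero (hD : IsOpen D) (hconj : ∀ z ∈ D, conj z ∈ D)
    (hxD : x ∈ axial D) (hx : x.im ≠ 0) :
    ∀ᶠ y in 𝓝 x, y ∈ axial D ∧ y.im ≠ 0 :=
  ((isOpen_axial hD hconj).eventually_mem hxD).and (eventually_im_ne_zero hx)

/-- Used to see that `Δ g` is a slice function: on a sphere, the right-hand side depends on the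
point only through the imaginary unit, and affinely. -/
theorem laplacian_slice
    (hD : IsOpen D) (hconj : ∀ z ∈ D, conj z ∈ D) (hs : IsStem D F₁ F₂)
    (hF : HolomorphicStem D F₁ F₂) (hg : Induces D F₁ F₂ g) (hxD : x ∈ axial D) (hx : x.im ≠ 0) :
    Δ g x = -((2 : ℝ) • (dα (divIm F₂) (toUpper x) - unitIm x * dβ (divIm F₂) (toUpper x))) := by
  have hxD' := (mem_axial hconj).1 hxD
  have h1 : fueter g =ᶠ[𝓝 x] -(divIm F₂ ∘ toUpper) := by
    filter_upwards [eventually_axial_im_ne_zero hD hconj hxD hx] with y hy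
    exact fueter_slice hD hconj hs hF hg hy.1 hy.2
  rw [laplacian_eq_conjFueter_fueter (hg.contDiffAt hs hF hD hconj hxD), conjFueter_congr h1,
    conjFueter_neg, conjFueter_comp_toUpper hx (hasFDerivAt_divIm (toUpper_im_ne_zero hx)
      (hF _ hxD').2.1).differentiableAt]
  module

theorem fueter_laplacian_slice
    (hD : IsOpen D) (hconj : ∀ z ∈ D, conj z ∈ D) (hs : IsStem D F₁ F₂)
    (hF : HolomorphicStem D F₁ F₂) (hg : Induces D F₁ F₂ g) (hxD : x ∈ axial D) (hx : x.im ≠ 0) :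
    fueter (Δ g) x = 0 := by
  have h1 : fueter g =ᶠ[𝓝 x] -(divIm F₂ ∘ toUpper) := by
    filter_upwards [eventually_axial_im_ne_zero hD hconj hxD hx] with y hy
    exact fueter_slice hD hconj hs hF hg hy.1 hy.2
  rw [fueter_laplacian (hg.contDiffAt hs hF hD hconj hxD),
    (InnerProductSpace.laplacian_congr_nhds h1).eq_of_nhds, InnerProductSpace.laplacian_neg,
    Pi.neg_apply, laplacian_divIm hF hD ((mem_axial hconj).1 hxD) hx, neg_zero]

/-- Commute `∂̄` with `Δ` and insert `∂̄g = g' + F₂/β`; the second summand is harmonic. -/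
theorem conjFueter_laplacian_slice
    (hD : IsOpen D) (hconj : ∀ z ∈ D, conj z ∈ D) (hs : IsStem D F₁ F₂)
    (hF : HolomorphicStem D F₁ F₂) (hg : Induces D F₁ F₂ g) (hxD : x ∈ axial D) (hx : x.im ≠ 0) :
    conjFueter (Δ g) x = Δ (sliceDeriv g) x := by
  have h1 : conjFueter g =ᶠ[𝓝 x] sliceDeriv g + divIm F₂ ∘ toUpper := by
    filter_upwards [eventually_axial_im_ne_zero hD hconj hxD hx] with y hy
    exact conjFueter_slice hD hconj hs hF hg hy.1 hy.2
  have hxD' := (mem_axial hconj).1 hxD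
  have hc : ContDiffAt ℝ 2 (divIm F₂ ∘ toUpper) x := contDiffAt_comp_toUpper hx
    (contDiffAt_divIm (toUpper_im_ne_zero hx) (hF.contDiffAt hD hxD').2)
  rw [conjFueter_laplacian (hg.contDiffAt hs hF hD hconj hxD),
    (InnerProductSpace.laplacian_congr_nhds h1).eq_of_nhds, ContDiffAt.laplacian_add
      (contDiffAt_of_mem_SR (sliceDeriv_mem_SR hD hconj ⟨_, _, hs, hF, hg⟩) hD hconj hxD) hc,
    laplacian_divIm hF hD hxD' hx, add_zero]

/-- A continuous function vanishing at the nonreal points near `x` vanishes at `x`. -/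
theorem eq_zero_of_eventually_im_ne_zero {G : ℍ[ℝ] → ℍ[ℝ]} (hG : ContinuousAt G x)
    (h : ∀ᶠ y in 𝓝 x, y.im ≠ 0 → G y = 0) : G x = 0 := by
  by_cases hx : x.im = 0
  · have h1 : Tendsto (fun t : ℝ => x + t • qi) (𝓝[≠] 0) (𝓝 x) := by
      have : Continuous fun t : ℝ => x + t • qi := by fun_prop
      have := this.tendsto 0
      rw [zero_smul, add_zero] at this
      exact this.mono_left nhdsWithin_le_nhds
    have h2 : ∀ᶠ t : ℝ in 𝓝[≠] 0, G (x + t • qi) = 0 := by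
      filter_upwards [h1.eventually h, self_mem_nhdsWithin] with t ht ht0
      refine ht fun h0 => ht0 ?_
      have := congrArg QuaternionAlgebra.imI h0
      have hxI := congrArg QuaternionAlgebra.imI hx
      simp at this hxI
      simpa [hxI] using this
    exact tendsto_nhds_unique (hG.tendsto.comp h1)
      (tendsto_const_nhds.congr' (h2.mono fun t ht => ht.symm))
  · exact h.self_of_nhds hx

theorem conjFueter_laplacian_of_mem_SR (hD : IsOpen D) (hconj : ∀ z ∈ D, conj z ∈ D)
    (hg : g ∈ SR D) (hx : x ∈ axial D) : conjFueter (Δ g) x = Δ (sliceDeriv g) x := by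
  have c1 : ContDiffAt ℝ 0 (conjFueter (Δ g)) x :=
    ((contDiffAt_of_mem_SR (n := 3) hg hD hconj hx).quaternion_laplacian (m := 1)
      (by norm_num)).conjFueter (by norm_num)
  have c2 : ContDiffAt ℝ 0 (Δ (sliceDeriv g)) x :=
    (contDiffAt_of_mem_SR (n := 2) (sliceDeriv_mem_SR hD hconj hg) hD hconj
      hx).quaternion_laplacian (by norm_num)
  rw [← sub_eq_zero]
  refine eq_zero_of_eventually_im_ne_zero (G := fun y => conjFueter (Δ g) y - Δ (sliceDeriv g) y)
    (c1.sub c2).continuousAt ?_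
  obtain ⟨F₁, F₂, hs, hF, hi⟩ := hg
  filter_upwards [(isOpen_axial hD hconj).mem_nhds hx] with y hy hy0
  rw [conjFueter_laplacian_slice hD hconj hs hF hi hy hy0, sub_self]

theorem laplacian_mem_AM (hD : IsOpen D) (hconj : ∀ z ∈ D, conj z ∈ D) (hg : g ∈ SR D) :
    Δ g ∈ AM D := by
  have hc : ∀ x ∈ axial D, ContDiffAt ℝ 1 (Δ g) x := fun x hx =>
    (contDiffAt_of_mem_SR (n := 3) hg hD hconj hx).quaternion_laplacian (by norm_num)
  obtain ⟨F₁, F₂, hs, hF, hi⟩ := hg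
  refine ⟨mem_sliceFunctions hconj fun z hz hp => ?_, fun x hx => (hc x hx).contDiffWithinAt,
    fun x hx => ?_⟩
  · refine ⟨-((2 : ℝ) • dα (divIm F₂) z), (2 : ℝ) • dβ (divIm F₂) z, fun J hJ => ?_⟩
    have e1 : toUpper ((z.re : ℍ[ℝ]) + J * (z.im : ℍ[ℝ])) = z := by
      rw [toUpper_slice hJ, abs_of_pos hp]
    have e2 := unitIm_slice_of_pos hJ z.re hp
    have e3 : ((z.re : ℍ[ℝ]) + J * (z.im : ℍ[ℝ])).im ≠ 0 := by
      rw [← norm_ne_zero_iff, norm_im_slice hJ]; exact (abs_pos.2 hp.ne').ne'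
    rw [laplacian_slice hD hconj hs hF hi ⟨z, hz, J, hJ, rfl⟩ e3, e1, e2, mul_smul_comm]
    module
  · refine eq_zero_of_eventually_im_ne_zero ?_ ?_
    · exact ((hc x hx).fueter (m := 0) (by norm_num)).continuousAt
    · filter_upwards [(isOpen_axial hD hconj).mem_nhds hx] with y hy hy0
      exact fueter_laplacian_slice hD hconj hs hF hi hy hy0

theorem AM_congr (hD : IsOpen D) (hconj : ∀ z ∈ D, conj z ∈ D) {f : ℍ[ℝ] → ℍ[ℝ]} (hg : g ∈ AM D)
    (h : ∀ x ∈ axial D, f x = g x) : f ∈ AM D := by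
  obtain ⟨⟨F₁, F₂, hs, hi⟩, hc, h0⟩ := hg
  refine ⟨⟨F₁, F₂, hs, hi.congr fun x hx => (h x hx).symm⟩, hc.congr h, fun x hx => ?_⟩
  rw [fueter_congr (eventually_of_mem ((isOpen_axial hD hconj).mem_nhds hx) h), h0 x hx]

end SliceLaplacian

/-! ### The polynomials `P n`: recurrences, bounds and the Appell rule -/

section Polynomials

/-- The real-valued polynomials `∑_{k<m} x̄^k x^{m-1-k}`. -/
def zonal : ℕ → ℍ[ℝ] → ℍ[ℝ]
  | 0, _ => 0
  | m + 1, x => zonal m x * x + star x ^ m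

/-- The polynomials `∑_{k<m} A_k x^{m-1-k}`, where `A_k` are the polynomials `zonal`. -/
def zonalSum : ℕ → ℍ[ℝ] → ℍ[ℝ]
  | 0, _ => 0
  | m + 1, x => zonalSum m x * x + zonal m x

theorem zonal_succ (m : ℕ) (x : ℍ[ℝ]) : zonal (m + 1) x = zonal m x * x + star x ^ m := rfl

theorem zonalSum_succ (m : ℕ) (x : ℍ[ℝ]) : zonalSum (m + 1) x = zonalSum m x * x + zonal m x := rfl

theorem zonal_succ' (m : ℕ) (x : ℍ[ℝ]) : zonal (m + 1) x = star x * zonal m x + x ^ m := by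
  induction m with
  | zero => simp [zonal]
  | succ m ih =>
    rw [zonal_succ (m + 1)]
    nth_rewrite 1 [ih]
    rw [zonal_succ m]
    simp only [add_mul, mul_add, mul_assoc, pow_succ x, pow_succ' (star x)]
    abel

theorem star_zonal (m : ℕ) (x : ℍ[ℝ]) : star (zonal m x) = zonal m x := by
  induction m with
  | zero => simp [zonal]
  | succ m ih =>
    rw [zonal_succ, star_add, star_mul, star_pow, star_star, ih, ← zonal_succ', zonal_succ]

theorem zonal_eq_coe (m : ℕ) (x : ℍ[ℝ]) : zonal m x = ((zonal m x).re : ℍ[ℝ]) :=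
  Quaternion.star_eq_self.1 (star_zonal m x)

theorem zonal_commute (m : ℕ) (x y : ℍ[ℝ]) : zonal m x * y = y * zonal m x := by
  rw [zonal_eq_coe, Quaternion.coe_commutes]

/-- Since `(x - x̄) A_k = x^k - x̄^k`, the sum of the `(x - x̄) A_k x^(m-k)` over `k ≤ m` is `∑ (x^m
- x̄^k x^(m-k))`. -/
theorem sub_star_mul_zonalSum (m : ℕ) (x : ℍ[ℝ]) :
    (x - star x) * zonalSum (m + 1) x = ((m : ℝ) + 1) • x ^ m - zonal (m + 1) x := by
  induction m with
  | zero => simp [zonalSum, zonal]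
  | succ m ih =>
    rw [zonalSum_succ (m + 1), mul_add, ← mul_assoc, ih, sub_mul, sub_mul x, smul_mul_assoc,
      ← pow_succ, zonal_commute, zonal_succ' (m + 1)]
    push_cast
    module

theorem zonalSum_commute (m : ℕ) (x : ℍ[ℝ]) : zonalSum m x * x = x * zonalSum m x := by
  induction m with
  | zero => simp [zonalSum]
  | succ m ih => rw [zonalSum_succ, add_mul, mul_add, zonal_commute, ← mul_assoc, ← ih]

/-- Gives twice the real part of `zonalSum`, the correction term in the product rule used for the
Appell property. -/
theorem zonalSum_add_star (m : ℕ) (x : ℍ[ℝ]) :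
    zonalSum (m + 1) x + star (zonalSum (m + 1) x) = ((m : ℝ) + 1) • zonal m x := by
  induction m with
  | zero => simp [zonalSum, zonal]
  | succ m ih =>
    have h1 : star (zonalSum (m + 1) x) = ((m : ℝ) + 1) • zonal m x - zonalSum (m + 1) x :=
      eq_sub_of_add_eq' ih
    have h2 := sub_star_mul_zonalSum m x
    have h3 := zonal_succ' m x
    have h4 : star x * zonal m x = zonal (m + 1) x - x ^ m := eq_sub_of_add_eq h3.symm
    rw [sub_mul] at h2
    have h5 : x * zonalSum (m + 1) x =
        star x * zonalSum (m + 1) x + (((m : ℝ) + 1) • x ^ m - zonal (m + 1) x) := by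
      rw [← h2]; abel
    rw [zonalSum_succ (m + 1), star_add, star_mul, star_zonal, h1, zonalSum_commute, h5, mul_sub,
      mul_smul_comm, h4]
    push_cast
    module

/-- There are `m` monomials of degree `m - 1`. The factor `ρ` on the left avoids the truncated
exponent; the derivative bounds below follow the same convention. -/
theorem norm_mul_norm_zonal_le (m : ℕ) {x : ℍ[ℝ]} {ρ : ℝ} (hx : ‖x‖ ≤ ρ) :
    ρ * ‖zonal m x‖ ≤ m * ρ ^ m := by
  have hρ : 0 ≤ ρ := (norm_nonneg x).trans hx
  induction m with
  | zero => simp [zonal]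
  | succ m ih =>
    have h1 : ‖zonal (m + 1) x‖ ≤ ‖zonal m x‖ * ρ + ρ ^ m := by
      rw [zonal_succ]
      refine (norm_add_le _ _).trans ?_
      rw [norm_mul, norm_pow, norm_star]
      gcongr
    calc ρ * ‖zonal (m + 1) x‖ ≤ ρ * (‖zonal m x‖ * ρ + ρ ^ m) := by gcongr
      _ = (ρ * ‖zonal m x‖) * ρ + ρ ^ (m + 1) := by ring
      _ ≤ (m * ρ ^ m) * ρ + ρ ^ (m + 1) := by gcongr
      _ = _ := by push_cast; ring

/-- The trivial bound `(n + 2)‖x‖^(n+1)` for `zonal (n + 2) x` would exactly cancel the main term.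
Pairing two monomials as `x^(n+1) + x̄ x^n = 2 Re(x) x^n` leaves a gain that is positive for nonreal
`x`. -/
theorem le_norm_zonalSum (n : ℕ) (x : ℍ[ℝ]) :
    2 * (‖x‖ - |x.re|) * ‖x‖ ^ n ≤ ‖x - star x‖ * ‖zonalSum (n + 2) x‖ := by
  have h1 : zonal (n + 2) x = star x * (star x * zonal n x) + (2 * x.re) • x ^ n := by
    have : (2 * x.re) • x ^ n = (x + star x) * x ^ n := by
      rw [Quaternion.self_add_star', Quaternion.coe_mul_eq_smul]
    rw [zonal_succ', zonal_succ', mul_add, this, add_mul, pow_succ']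
    abel
  have h2 : ‖zonal (n + 2) x‖ ≤ n * ‖x‖ ^ (n + 1) + 2 * |x.re| * ‖x‖ ^ n := by
    rw [h1]
    refine (norm_add_le _ _).trans ?_
    rw [norm_mul, norm_mul, norm_star, norm_smul, norm_pow, norm_mul, Real.norm_eq_abs,
      Real.norm_eq_abs, abs_two]
    refine add_le_add ?_ le_rfl
    calc ‖x‖ * (‖x‖ * ‖zonal n x‖) ≤ ‖x‖ * (n * ‖x‖ ^ n) :=
          mul_le_mul_of_nonneg_left (norm_mul_norm_zonal_le n le_rfl) (norm_nonneg x)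
      _ = _ := by ring
  rw [← norm_mul, sub_star_mul_zonalSum]
  refine le_trans ?_ (norm_sub_norm_le _ _)
  rw [norm_smul, norm_pow, Real.norm_of_nonneg (by positivity)]
  push_cast
  calc _ = ((n : ℝ) + 1 + 1) * ‖x‖ ^ (n + 1) - (n * ‖x‖ ^ (n + 1) + 2 * |x.re| * ‖x‖ ^ n) := by ring
    _ ≤ _ := by gcongr

theorem zonal_smul (m : ℕ) (t : ℝ) (x : ℍ[ℝ]) : zonal (m + 1) (t • x) = t ^ m • zonal (m + 1) x := by
  induction m with
  | zero => simp [zonal]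
  | succ m ih =>
    rw [zonal_succ, ih, zonal_succ (m + 1), Quaternion.star_smul, smul_pow, smul_mul_smul_comm, ← pow_succ,
      smul_add]

theorem zonalSum_smul (m : ℕ) (t : ℝ) (x : ℍ[ℝ]) :
    zonalSum (m + 2) (t • x) = t ^ m • zonalSum (m + 2) x := by
  induction m with
  | zero => simp [zonalSum, zonal]
  | succ m ih =>
    rw [zonalSum_succ, ih, zonalSum_succ (m + 2), zonal_smul, smul_mul_smul_comm, ← pow_succ,
      smul_add]

variable {f g : ℍ[ℝ] → ℍ[ℝ]} {x : ℍ[ℝ]}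

/-- Quaternion conjugation as a continuous linear map. -/
def starL : ℍ[ℝ] →L[ℝ] ℍ[ℝ] :=
  LinearMap.toContinuousLinearMap
    { toFun := fun x => star x, map_add' := fun _ _ => star_add _ _,
      map_smul' := fun _ _ => Quaternion.star_smul _ _ }

@[simp] theorem starL_apply (x : ℍ[ℝ]) : starL x = star x := rfl

/-- This sum and the next are what the product rule leaves when `∂`, respectively `∂̄`, is applied
to `f(x) x`. -/
theorem add_units_mul_mul_units (q : ℍ[ℝ]) :
    q + qi * q * qi + qj * q * qj + qk * q * qk = -((2 : ℝ) • star q) := by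
  ext <;> simp <;> ring

theorem sub_units_mul_mul_units (q : ℍ[ℝ]) :
    q - qi * q * qi - qj * q * qj - qk * q * qk = ((4 * q.re : ℝ) : ℍ[ℝ]) := by
  ext <;> simp
  ring

theorem fueter_mul_id (hf : DifferentiableAt ℝ f x) :
    fueter (fun y => f y * y) x = fueter f x * x - star (f x) := by
  have h := hf.hasFDerivAt.mul' (hasFDerivAt_id x)
  rw [show fueter (fun y => f y * y) x = _ from h.fueter, fueter]
  have h2 := add_units_mul_mul_units (f x)
  have h3 : star (f x) = -((2⁻¹ : ℝ) • (f x + qi * f x * qi + qj * f x * qj + qk * f x * qk)) := by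
    rw [h2]; module
  rw [h3]
  simp [mul_add, add_mul, mul_assoc]
  module

theorem conjFueter_mul_id (hf : DifferentiableAt ℝ f x) :
    conjFueter (fun y => f y * y) x = conjFueter f x * x + ((2 * (f x).re : ℝ) : ℍ[ℝ]) := by
  have h := hf.hasFDerivAt.mul' (hasFDerivAt_id x)
  rw [show conjFueter (fun y => f y * y) x = _ from h.conjFueter, conjFueter]
  have h3 : ((2 * (f x).re : ℝ) : ℍ[ℝ]) =
      (2⁻¹ : ℝ) • (f x - qi * f x * qi - qj * f x * qj - qk * f x * qk) := by
    rw [sub_units_mul_mul_units, ← Quaternion.coe_smul]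
    congr 1; simp; ring
  rw [h3]
  simp [mul_add, sub_mul, mul_assoc]
  module

theorem conjFueter_mul_star (hf : DifferentiableAt ℝ f x) :
    conjFueter (fun y => f y * star y) x = conjFueter f x * star x - star (f x) := by
  have h := hf.hasFDerivAt.mul' (starL.hasFDerivAt (x := x))
  rw [show conjFueter (fun y => f y * star y) x = _ from h.conjFueter, conjFueter]
  have h3 : star (f x) = -((2⁻¹ : ℝ) • (f x + qi * f x * qi + qj * f x * qj + qk * f x * qk)) := by
    rw [add_units_mul_mul_units]; module
  have ei : star qi = -qi := by ext <;> simp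
  have ej : star qj = -qj := by ext <;> simp
  have ek : star qk = -qk := by ext <;> simp
  rw [h3]
  simp [mul_add, sub_mul, mul_assoc, ei, ej, ek]
  module

theorem fueter_mul_const (hf : DifferentiableAt ℝ f x) (a : ℍ[ℝ]) :
    fueter (fun y => f y * a) x = fueter f x * a := by
  rw [(hf.hasFDerivAt.mul_const' a).fueter, fueter]
  simp [add_mul, mul_assoc]

theorem conjFueter_mul_const (hf : DifferentiableAt ℝ f x) (a : ℍ[ℝ]) :
    conjFueter (fun y => f y * a) x = conjFueter f x * a := by
  rw [(hf.hasFDerivAt.mul_const' a).conjFueter, conjFueter]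
  simp [sub_mul, mul_assoc]

theorem differentiable_star_pow (m : ℕ) : Differentiable ℝ (fun y : ℍ[ℝ] => star y ^ m) :=
  starL.differentiable.pow m

theorem differentiable_zonal (m : ℕ) : Differentiable ℝ (zonal m) := by
  induction m with
  | zero => exact differentiable_const 0
  | succ m ih => exact (ih.mul differentiable_id).add (differentiable_star_pow m)

theorem fueter_const (c : ℍ[ℝ]) : fueter (fun _ => c) x = 0 := by simp [fueter]
theorem conjFueter_const (c : ℍ[ℝ]) : conjFueter (fun _ => c) x = 0 := by simp [conjFueter]

theorem fueter_pow (m : ℕ) : fueter (fun y : ℍ[ℝ] => y ^ m) = -zonal m := by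
  induction m with
  | zero => funext x; simp [fueter_const, zonal]
  | succ m ih =>
    funext x
    simp only [pow_succ]
    rw [fueter_mul_id (differentiable_pow m x), ih, Pi.neg_apply, Pi.neg_apply, zonal_succ, star_pow]
    rw [neg_mul]; abel

theorem conjFueter_star_pow (m : ℕ) (x : ℍ[ℝ]) :
    conjFueter (fun y : ℍ[ℝ] => star y ^ m) x = -zonal m x := by
  induction m with
  | zero => simp [conjFueter_const, zonal]
  | succ m ih =>
    simp only [pow_succ]
    rw [conjFueter_mul_star (differentiable_star_pow m x), ih, zonal_succ', star_pow, star_star,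
      neg_mul, zonal_commute]
    abel

theorem conjFueter_zonal (m : ℕ) (x : ℍ[ℝ]) : conjFueter (zonal m) x = zonalSum m x := by
  induction m with
  | zero => exact conjFueter_const 0
  | succ m ih =>
    have h1 : DifferentiableAt ℝ (fun y => zonal m y * y) x :=
      (differentiable_zonal m x).mul differentiableAt_id
    have : zonal (m + 1) = (fun y => zonal m y * y) + fun y => star y ^ m := rfl
    rw [this, conjFueter_add h1 (differentiable_star_pow m x),
      conjFueter_mul_id (differentiable_zonal m x), conjFueter_star_pow, ih, zonalSum_succ]
    have h2 : ((2 * (zonal m x).re : ℝ) : ℍ[ℝ]) = (2 : ℝ) • zonal m x := by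
      conv_rhs => rw [zonal_eq_coe, ← Quaternion.coe_smul, smul_eq_mul]
    rw [h2]; module

theorem differentiable_zonalSum (m : ℕ) : Differentiable ℝ (zonalSum m) := by
  induction m with
  | zero => exact differentiable_const 0
  | succ m ih => exact (ih.mul differentiable_id).add (differentiable_zonal m)

/-- In the inductive step the product rule contributes `2 Re(zonalSum (m + 1) x)`, that is `(m + 1)
zonal m x`, which completes `(m + 1) zonalSum m x * x` to `(m + 1) zonalSum (m + 1) x`; `∂̄` of the
remaining summand adds one more copy. -/
theorem conjFueter_zonalSum (m : ℕ) (x : ℍ[ℝ]) :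
    conjFueter (zonalSum (m + 1)) x = ((m : ℝ) + 1) • zonalSum m x := by
  induction m with
  | zero =>
    have : zonalSum 1 = fun _ => 0 := by funext y; simp [zonalSum, zonal]
    rw [this, conjFueter_const, zonalSum, smul_zero]
  | succ m ih =>
    have h1 : DifferentiableAt ℝ (fun y => zonalSum (m + 1) y * y) x :=
      (differentiable_zonalSum (m + 1) x).mul differentiableAt_id
    have e : zonalSum (m + 2) = (fun y => zonalSum (m + 1) y * y) + zonal (m + 1) := rfl
    rw [e, conjFueter_add h1 (differentiable_zonal _ x),
      conjFueter_mul_id (differentiable_zonalSum _ x), conjFueter_zonal, ih,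
      ← Quaternion.self_add_star', zonalSum_add_star, zonalSum_succ m, smul_mul_assoc]
    push_cast
    module

/-- By `¼Δ = ∂̄∂` and `∂(x^(n+2)) = -zonal (n + 2)`. -/
theorem P_eq_zonalSum (n : ℕ) : P n = zonalSum (n + 2) := by
  funext x
  have hc : ContDiffAt ℝ 2 (fun y : ℍ[ℝ] => y ^ (n + 2)) x := (contDiff_id.pow _).contDiffAt
  rw [P, Pi.neg_apply, Pi.smul_apply, ← conjFueter_fueter hc, fueter_pow, conjFueter_neg, neg_neg,
    conjFueter_zonal]

theorem conjFueter_P {n : ℕ} (hn : 1 ≤ n) (x : ℍ[ℝ]) :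
    conjFueter (P n) x = ((n : ℝ) + 2) • P (n - 1) x := by
  obtain ⟨m, rfl⟩ := Nat.exists_eq_add_of_le' hn
  rw [P_eq_zonalSum, P_eq_zonalSum, conjFueter_zonalSum, Nat.add_sub_cancel]
  push_cast
  module

theorem norm_fderiv_mul_le (hf : DifferentiableAt ℝ f x) (hg : DifferentiableAt ℝ g x) :
    ‖fderiv ℝ (fun y => f y * g y) x‖ ≤ ‖f x‖ * ‖fderiv ℝ g x‖ + ‖fderiv ℝ f x‖ * ‖g x‖ := by
  have h := hf.hasFDerivAt.mul' hg.hasFDerivAt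
  rw [show fderiv ℝ (fun y => f y * g y) x = _ from h.fderiv]
  refine ContinuousLinearMap.opNorm_le_bound _ (by positivity) fun v => ?_
  simp only [add_apply, smul_apply, smul_eq_mul, MulOpposite.smul_eq_mul_unop,
    MulOpposite.unop_op]
  refine (norm_add_le _ _).trans ?_
  rw [norm_mul, norm_mul, add_mul]
  have h1 := (fderiv ℝ g x).le_opNorm v
  have h2 := (fderiv ℝ f x).le_opNorm v
  calc ‖f x‖ * ‖fderiv ℝ g x v‖ + ‖fderiv ℝ f x v‖ * ‖g x‖
      ≤ ‖f x‖ * (‖fderiv ℝ g x‖ * ‖v‖) + (‖fderiv ℝ f x‖ * ‖v‖) * ‖g x‖ := by gcongr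
    _ = _ := by ring

theorem norm_fderiv_pow_le (s : ℍ[ℝ] →L[ℝ] ℍ[ℝ]) (hs : ∀ y, ‖s y‖ ≤ ‖y‖) (m : ℕ) {ρ : ℝ}
    (hx : ‖x‖ ≤ ρ) : ρ * ‖fderiv ℝ (fun y => s y ^ m) x‖ ≤ m * ρ ^ m := by
  have hρ : 0 ≤ ρ := (norm_nonneg x).trans hx
  have h1 : ‖fderiv ℝ s x‖ ≤ 1 := by
    rw [s.fderiv]
    exact s.opNorm_le_bound zero_le_one fun y => by rw [one_mul]; exact hs y
  induction m with
  | zero =>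
    have h0 : ‖(0 : ℍ[ℝ] →L[ℝ] ℍ[ℝ])‖ = 0 := ContinuousLinearMap.opNorm_zero
    simp [h0]
  | succ m ih =>
    simp only [pow_succ]
    have h2 := norm_fderiv_mul_le (f := fun y => s y ^ m) (x := x) (s.differentiable.pow m x)
      (s.differentiable x)
    have h3 : ‖s x ^ m‖ ≤ ρ ^ m := by
      rw [norm_pow]; gcongr; exact (hs x).trans hx
    have h4 : ‖s x‖ ≤ ρ := (hs x).trans hx
    calc ρ * ‖fderiv ℝ (fun y => s y ^ m * s y) x‖
        ≤ ρ * (ρ ^ m * 1 + ‖fderiv ℝ (fun y => s y ^ m) x‖ * ρ) := by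
          refine mul_le_mul_of_nonneg_left (h2.trans ?_) hρ
          gcongr
      _ = ρ ^ m * ρ + (ρ * ‖fderiv ℝ (fun y => s y ^ m) x‖) * ρ := by ring
      _ ≤ ρ ^ m * ρ + (m * ρ ^ m) * ρ := by gcongr
      _ = _ := by push_cast; ring

theorem norm_fderiv_zonal_le (m : ℕ) {ρ : ℝ} (hx : ‖x‖ ≤ ρ) :
    ρ ^ 2 * ‖fderiv ℝ (zonal m) x‖ ≤ m ^ 2 * ρ ^ m := by
  have hρ : 0 ≤ ρ := (norm_nonneg x).trans hx
  induction m with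
  | zero =>
    have h0 : ‖(0 : ℍ[ℝ] →L[ℝ] ℍ[ℝ])‖ = 0 := ContinuousLinearMap.opNorm_zero
    have : zonal 0 = fun _ => 0 := rfl
    simp [this, h0]
  | succ m ih =>
    have h1 : DifferentiableAt ℝ (fun y => zonal m y * y) x :=
      (differentiable_zonal m x).mul differentiableAt_id
    have e : zonal (m + 1) = (fun y => zonal m y * y) + fun y => star y ^ m := rfl
    have h2 := norm_fderiv_mul_le (differentiable_zonal m x) (differentiableAt_id (𝕜 := ℝ) (x := x))
    simp only [id, fderiv_id] at h2
    have h3 := norm_fderiv_pow_le starL (fun y => (norm_star y).le) m hx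
    have h4 := norm_mul_norm_zonal_le m hx
    have h5 : ‖ContinuousLinearMap.id ℝ ℍ[ℝ]‖ ≤ 1 := ContinuousLinearMap.norm_id_le
    have h6 : ‖fderiv ℝ (zonal (m + 1)) x‖ ≤ (‖zonal m x‖ * 1 + ‖fderiv ℝ (zonal m) x‖ * ρ) +
        ‖fderiv ℝ (fun y : ℍ[ℝ] => starL y ^ m) x‖ := by
      rw [e, fderiv_add h1 (differentiable_star_pow m x)]
      refine (ContinuousLinearMap.opNorm_add_le _ _).trans (add_le_add (h2.trans ?_) le_rfl)
      gcongr
    calc ρ ^ 2 * ‖fderiv ℝ (zonal (m + 1)) x‖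
        ≤ ρ ^ 2 * ((‖zonal m x‖ * 1 + ‖fderiv ℝ (zonal m) x‖ * ρ) +
          ‖fderiv ℝ (fun y : ℍ[ℝ] => starL y ^ m) x‖) := by gcongr
      _ = ρ * (ρ * ‖zonal m x‖) + (ρ ^ 2 * ‖fderiv ℝ (zonal m) x‖) * ρ +
          ρ * (ρ * ‖fderiv ℝ (fun y : ℍ[ℝ] => starL y ^ m) x‖) := by ring
      _ ≤ ρ * (m * ρ ^ m) + (m ^ 2 * ρ ^ m) * ρ + ρ * (m * ρ ^ m) := by gcongr
      -- The added term completes `m² + 2m` to `(m + 1)²`.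
      _ ≤ ρ * (m * ρ ^ m) + (m ^ 2 * ρ ^ m) * ρ + ρ * (m * ρ ^ m) + ρ ^ m * ρ :=
          le_add_of_nonneg_right (by positivity)
      _ = _ := by push_cast; ring

end Polynomials

/-! ### Power series, termwise differentiation and the explicit right inverse -/

section Series

section Termwise

variable {f : ℕ → ℍ[ℝ] → ℍ[ℝ]} {u : ℕ → ℝ} {ρ : ℝ} {x : ℍ[ℝ]}

theorem hasFDerivAt_tsum_ball {E F : Type*} [NormedAddCommGroup E] [NormedSpace ℝ E]
    [NormedAddCommGroup F] [NormedSpace ℝ F] [CompleteSpace F] {f : ℕ → E → F} {x : E}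
    (hu : Summable u) (hd : ∀ n, Differentiable ℝ (f n))
    (hb : ∀ n y, ‖y‖ < ρ → ‖fderiv ℝ (f n) y‖ ≤ u n) (h0 : Summable fun n => f n 0)
    (hx : ‖x‖ < ρ) :
    HasFDerivAt (fun y => ∑' n, f n y) (∑' n, fderiv ℝ (f n) x) x ∧
      Summable fun n => fderiv ℝ (f n) x := by
  have hρ : 0 < ρ := (norm_nonneg x).trans_lt hx
  refine ⟨hasFDerivAt_tsum_of_isPreconnected (s := Metric.ball 0 ρ) hu Metric.isOpen_ball
    (convex_ball _ _).isPreconnected (fun n y _ => (hd n y).hasFDerivAt)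
    (fun n y hy => hb n y (by simpa using hy)) (Metric.mem_ball_self hρ) h0 (by simpa using hx), ?_⟩
  exact Summable.of_norm_bounded hu fun n => hb n x hx

theorem hasSum_fueter_tsum (hu : Summable u) (hd : ∀ n, Differentiable ℝ (f n))
    (hb : ∀ n y, ‖y‖ < ρ → ‖fderiv ℝ (f n) y‖ ≤ u n) (h0 : Summable fun n => f n 0)
    (hx : ‖x‖ < ρ) :
    HasSum (fun n => fueter (f n) x) (fueter (fun y => ∑' n, f n y) x) := by
  obtain ⟨h1, h2⟩ := hasFDerivAt_tsum_ball hu hd hb h0 hx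
  have h3 (v : ℍ[ℝ]) := (ContinuousLinearMap.apply ℝ ℍ[ℝ] v).hasSum h2.hasSum
  rw [h1.fueter]
  exact ((((h3 1).add ((h3 qi).mul_left qi)).add ((h3 qj).mul_left qj)).add
    ((h3 qk).mul_left qk)).const_smul (2⁻¹ : ℝ)

theorem hasSum_conjFueter_tsum (hu : Summable u) (hd : ∀ n, Differentiable ℝ (f n))
    (hb : ∀ n y, ‖y‖ < ρ → ‖fderiv ℝ (f n) y‖ ≤ u n) (h0 : Summable fun n => f n 0)
    (hx : ‖x‖ < ρ) :
    HasSum (fun n => conjFueter (f n) x) (conjFueter (fun y => ∑' n, f n y) x) := by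
  obtain ⟨h1, h2⟩ := hasFDerivAt_tsum_ball hu hd hb h0 hx
  have h3 (v : ℍ[ℝ]) := (ContinuousLinearMap.apply ℝ ℍ[ℝ] v).hasSum h2.hasSum
  rw [h1.conjFueter]
  exact ((((h3 1).sub ((h3 qi).mul_left qi)).sub ((h3 qj).mul_left qj)).sub
    ((h3 qk).mul_left qk)).const_smul (2⁻¹ : ℝ)

end Termwise

/-- Cauchy-type bound: the sequence `a n * R ^ n` is bounded. -/
def CoeffBound (a : ℕ → ℍ[ℝ]) (R : ℝ) : Prop := ∃ C, ∀ n, ‖a n‖ * R ^ n ≤ C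

/-- The power series `∑ x ^ (n + 2) a_n`. -/
def powSum (a : ℕ → ℍ[ℝ]) (x : ℍ[ℝ]) : ℍ[ℝ] := ∑' n, x ^ (n + 2) * a n

variable {a b : ℕ → ℍ[ℝ]} {R ρ : ℝ} {x : ℍ[ℝ]}

/-- Comparison with a geometric series of ratio `ρ / R`. The exponents `k = 0, 1, 2` serve the
values, the derivatives of powers and the derivatives of `zonal`. -/
theorem CoeffBound.summable (ha : CoeffBound a R) (hρ : 0 ≤ ρ) (hR : ρ < R) (k : ℕ) :
    Summable fun n : ℕ => ((n + 2 : ℕ) : ℝ) ^ k * ρ ^ (n + 2) * ‖a n‖ := by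
  obtain ⟨C, hC⟩ := ha
  have hR0 : 0 < R := hρ.trans_lt hR
  have h1 : Summable fun n : ℕ => (n : ℝ) ^ k * (ρ / R) ^ n :=
    summable_pow_mul_geometric_of_norm_lt_one k (by
      rw [Real.norm_of_nonneg (by positivity)]; exact (div_lt_one hR0).2 hR)
  have h2 := ((summable_nat_add_iff 2).2 h1).mul_left (R ^ 2 * C)
  refine Summable.of_nonneg_of_le (fun n => by positivity) (fun n => ?_) h2
  have h3 : ρ ^ (n + 2) * ‖a n‖ = (ρ / R) ^ (n + 2) * (R ^ 2 * (‖a n‖ * R ^ n)) := by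
    rw [div_pow]; field_simp; ring
  calc ((n + 2 : ℕ) : ℝ) ^ k * ρ ^ (n + 2) * ‖a n‖
      = ((n + 2 : ℕ) : ℝ) ^ k * ((ρ / R) ^ (n + 2) * (R ^ 2 * (‖a n‖ * R ^ n))) := by
        rw [← h3, mul_assoc]
    _ ≤ ((n + 2 : ℕ) : ℝ) ^ k * ((ρ / R) ^ (n + 2) * (R ^ 2 * C)) := by
        gcongr; exact hC n
    _ = _ := by ring

theorem CoeffBound.hasSum_powSum (ha : CoeffBound a R) (hx : ‖x‖ < R) :
    HasSum (fun n => x ^ (n + 2) * a n) (powSum a x) := by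
  refine (Summable.of_norm_bounded (ha.summable (norm_nonneg x) hx 0) fun n => ?_).hasSum
  rw [norm_mul, norm_pow, pow_zero, one_mul]

theorem norm_fderiv_mul_const_le {f : ℍ[ℝ] → ℍ[ℝ]} (hf : DifferentiableAt ℝ f x) (c : ℍ[ℝ]) :
    ‖fderiv ℝ (fun y => f y * c) x‖ ≤ ‖fderiv ℝ f x‖ * ‖c‖ := by
  have h := norm_fderiv_mul_le hf (differentiableAt_const c)
  have h0 : ‖(0 : ℍ[ℝ] →L[ℝ] ℍ[ℝ])‖ = 0 := ContinuousLinearMap.opNorm_zero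
  simpa [h0] using h

/-- Termwise application of the Laplacian to the series `∑ x ^ (n + 2) a_n`. -/
theorem CoeffBound.hasSum_laplacian (ha : CoeffBound a R) (hx : ‖x‖ < R)
    (hc : ContDiffAt ℝ 2 (powSum a) x) :
    HasSum (fun n => P n x * a n) (-((4⁻¹ : ℝ) • Δ (powSum a) x)) := by
  obtain ⟨ρ, hxρ, hρR⟩ := exists_between hx
  have hρ : 0 < ρ := (norm_nonneg x).trans_lt hxρ
  -- The Laplacian is passed through the sum as `4∂̄∂`, in two first-order passes, so bounds on
  -- first derivatives of `x^m` and `zonal m` suffice. The intermediate radius makes the first pass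
  -- valid near `x`.
  have h1 : ∀ y : ℍ[ℝ], ‖y‖ < ρ →
      fueter (powSum a) y = (-fun y => ∑' n, zonal (n + 2) y * a n) y := by
    intro y hy
    have hd (n : ℕ) : Differentiable ℝ fun y : ℍ[ℝ] => y ^ (n + 2) := differentiable_pow _
    have := hasSum_fueter_tsum (f := fun n y => y ^ (n + 2) * a n)
      ((ha.summable hρ.le hρR 1).mul_left ρ⁻¹) (fun n => (hd n).mul_const (a n))
      (fun n w hw => ?_) (ha.hasSum_powSum (x := 0) (by simpa using hρ.trans hρR)).summable hy
    · change HasSum _ (fueter (powSum a) y) at this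
      rw [← this.tsum_eq, Pi.neg_apply, ← tsum_neg]
      congr 1
      funext n
      rw [fueter_mul_const (hd n y), fueter_pow, Pi.neg_apply, neg_mul]
    · refine (norm_fderiv_mul_const_le (hd n w) (a n)).trans ?_
      have := norm_fderiv_pow_le (ContinuousLinearMap.id ℝ ℍ[ℝ]) (fun _ => le_rfl) (n + 2) hw.le
      rw [← mul_assoc]
      gcongr
      rw [le_inv_mul_iff₀ hρ, pow_one]
      exact this
  have h2 : fueter (powSum a) =ᶠ[𝓝 x] -fun y => ∑' n, zonal (n + 2) y * a n :=
    ((continuous_norm.tendsto x).eventually_lt_const hxρ).mono h1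
  rw [← conjFueter_fueter hc, conjFueter_congr h2, conjFueter_neg, neg_neg]
  have h3 := hasSum_conjFueter_tsum (f := fun n y => zonal (n + 2) y * a n)
      ((ha.summable hρ.le hρR 2).mul_left (ρ ^ 2)⁻¹)
      (fun n => (differentiable_zonal (n + 2)).mul_const (a n)) (fun n w hw => ?_) ?_ hxρ
  · refine h3.congr_fun fun n => ?_
    rw [conjFueter_mul_const (differentiable_zonal _ x), conjFueter_zonal, P_eq_zonalSum]
  · refine (norm_fderiv_mul_const_le (differentiable_zonal _ w) (a n)).trans ?_
    rw [← mul_assoc]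
    gcongr
    rw [le_inv_mul_iff₀ (by positivity)]
    exact norm_fderiv_zonal_le (n + 2) hw.le
  · have h4 (n : ℕ) : zonal (n + 2) 0 * a n = 0 := by
      simp [zonal_succ]
    simp only [h4]
    exact summable_zero

section SliceRegular

variable {D : Set ℂ}

theorem tsum_conj_pow_mul_ofReal (c : ℕ → ℝ) (z : ℂ) :
    ∑' n, (conj z) ^ (n + 2) * (c n : ℂ) = conj (∑' n, z ^ (n + 2) * (c n : ℂ)) := by
  rw [Complex.conj_tsum]
  simp

theorem norm_coordL_le (l : Fin 4) (q : ℍ[ℝ]) : ‖coordL l q‖ ≤ ‖q‖ := by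
  have := norm_inner_le_norm (𝕜 := ℝ) (quaternionBasis l) q
  rwa [quaternionBasis.orthonormal.1 l, one_mul] at this

theorem CoeffBound.summable_coord (ha : CoeffBound a R) (l : Fin 4) {z : ℂ} (hz : ‖z‖ < R) :
    Summable fun n => z ^ (n + 2) * (coordL l (a n) : ℂ) := by
  refine Summable.of_norm_bounded (ha.summable (norm_nonneg z) hz 0) fun n => ?_
  rw [norm_mul, norm_pow, pow_zero, one_mul, Complex.norm_real]
  gcongr
  exact norm_coordL_le l (a n)

theorem CoeffBound.differentiableAt_coord (ha : CoeffBound a R) (l : Fin 4) {z : ℂ}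
    (hz : ‖z‖ < R) :
    DifferentiableAt ℂ (fun z => ∑' n, z ^ (n + 2) * (coordL l (a n) : ℂ)) z := by
  obtain ⟨ρ, hzρ, hρR⟩ := exists_between hz
  have hρ : 0 ≤ ρ := (norm_nonneg z).trans hzρ.le
  have := Complex.differentiableOn_tsum_of_summable_norm (U := Metric.ball 0 ρ)
    (F := fun n z => z ^ (n + 2) * (coordL l (a n) : ℂ)) (ha.summable hρ hρR 0)
    (fun n => by fun_prop) Metric.isOpen_ball fun n w hw => by
      rw [norm_mul, norm_pow, pow_zero, one_mul, Complex.norm_real]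
      have : ‖w‖ ≤ ρ := by simpa using (Metric.mem_ball.1 hw).le
      gcongr
      exact norm_coordL_le l (a n)
  exact this.differentiableAt (Metric.isOpen_ball.mem_nhds (by simpa using hzρ))

/-- A convergent power series with right coefficients is slice-regular. -/
theorem powSum_mem_SR (h : ∀ z ∈ D, ∃ R, ‖z‖ < R ∧ CoeffBound a R) : powSum a ∈ SR D := by
  refine ⟨_, _, isStem_stemOf (h := fun l z => ∑' n, z ^ (n + 2) * (coordL l (a n) : ℂ))
    fun z _ l => tsum_conj_pow_mul_ofReal _ z, holomorphicStem_stemOf fun z hz l => ?_,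
    fun z hz J hJ => ?_⟩
  · obtain ⟨R, hR, ha⟩ := h z hz
    exact ha.differentiableAt_coord l hR
  · obtain ⟨R, hR, ha⟩ := h z hz
    rw [stemOf_slice _ _ hJ]
    have h1 (l : Fin 4) :=
      ((ha.summable_coord l hR).hasSum.map (unitHom hJ) (continuous_unitHom hJ)).mul_right
        (quaternionBasis l)
    rw [← (hasSum_sum fun l (_ : l ∈ Finset.univ) => h1 l).tsum_eq, powSum]
    congr 1
    funext n
    simp only [Function.comp, map_mul, map_pow, mul_assoc, ← Finset.mul_sum]
    rw [unitHom_apply]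
    congr 1
    conv_lhs => rw [← sum_coordL (a n)]
    refine Finset.sum_congr rfl fun l _ => ?_
    rw [unitHom_apply, Complex.ofReal_re, Complex.ofReal_im, Quaternion.coe_zero, mul_zero,
      add_zero, Quaternion.coe_mul_eq_smul]

end SliceRegular

theorem norm_sq_eq (x : ℍ[ℝ]) : ‖x‖ ^ 2 = x.re ^ 2 + ‖x.im‖ ^ 2 := by
  rw [sq, sq ‖x.im‖, ← Quaternion.normSq_eq_norm_mul_self, ← Quaternion.normSq_eq_norm_mul_self,
    Quaternion.normSq_def', Quaternion.normSq_def']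
  simp
  ring

theorem abs_re_lt_norm (hx : x.im ≠ 0) : |x.re| < ‖x‖ := by
  have h1 := norm_sq_eq x
  have h2 : 0 < ‖x.im‖ := norm_pos_iff.2 hx
  refine abs_lt_of_sq_lt_sq ?_ (norm_nonneg x)
  nlinarith

theorem P_ne_zero (n : ℕ) (hx : x.im ≠ 0) : P n x ≠ 0 := by
  intro h
  have h1 := le_norm_zonalSum n x
  have h2 := abs_re_lt_norm hx
  rw [P_eq_zonalSum] at h
  rw [h, norm_zero, mul_zero] at h1
  have h3 : 0 < ‖x‖ := (abs_nonneg _).trans_lt h2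
  have : 0 < 2 * (‖x‖ - |x.re|) * ‖x‖ ^ n := mul_pos (by linarith) (by positivity)
  linarith

theorem P_smul (n : ℕ) (t : ℝ) (x : ℍ[ℝ]) : P n (t • x) = t ^ n • P n x := by
  rw [P_eq_zonalSum, zonalSum_smul]

theorem exists_bound_of_tendsto {c : ℕ → ℍ[ℝ]} {s : ℍ[ℝ]}
    (h : Tendsto (fun N => ∑ n ∈ Finset.range N, c n) atTop (𝓝 s)) : ∃ C, ∀ n, ‖c n‖ ≤ C := by
  have h1 : Tendsto c atTop (𝓝 0) := by
    have := (h.comp (tendsto_add_atTop_nat 1)).sub h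
    simpa [Function.comp_def, Finset.sum_range_succ] using this
  obtain ⟨C, hC⟩ := (Metric.isBounded_range_of_tendsto _ h1).exists_norm_le
  exact ⟨C, fun n => hC _ ⟨n, rfl⟩⟩

/-- The terms of a convergent series are bounded, and the lower bound for `P n x` transfers this to
`a n`. -/
theorem coeffBound_of_tendsto {s : ℍ[ℝ]} (hx : x.im ≠ 0)
    (h : Tendsto (fun N => ∑ n ∈ Finset.range N, P n x * a n) atTop (𝓝 s)) :
    CoeffBound a ‖x‖ := by
  obtain ⟨C, hC⟩ := exists_bound_of_tendsto h
  have h2 : 0 < 2 * (‖x‖ - |x.re|) := by have := abs_re_lt_norm hx; linarith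
  refine ⟨(‖x - star x‖ * C) / (2 * (‖x‖ - |x.re|)), fun n => ?_⟩
  rw [le_div_iff₀ h2]
  have h1 := le_norm_zonalSum n x
  rw [← P_eq_zonalSum] at h1
  have h3 := hC n
  rw [norm_mul] at h3
  calc ‖a n‖ * ‖x‖ ^ n * (2 * (‖x‖ - |x.re|)) = ‖a n‖ * (2 * (‖x‖ - |x.re|) * ‖x‖ ^ n) := by ring
    _ ≤ ‖a n‖ * (‖x - star x‖ * ‖P n x‖) := by gcongr
    _ = ‖x - star x‖ * (‖P n x‖ * ‖a n‖) := by ring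
    _ ≤ _ := by gcongr

/-- In an open set every point is dominated in norm by a nonreal one. -/
theorem exists_norm_lt {U : Set ℍ[ℝ]} (hU : IsOpen U) (hx : x ∈ U) :
    ∃ y ∈ U, y.im ≠ 0 ∧ ‖x‖ < ‖y‖ := by
  obtain ⟨J, hJ, hJx, -⟩ := exists_unit x
  set z := toUpper x with hz
  have hz0 : 0 ≤ z.im := norm_nonneg _
  -- For `t > 0` the real part does not shrink and the imaginary part strictly grows, so the norm
  -- increases and the point is nonreal.
  let y : ℝ → ℍ[ℝ] := fun t => (((1 + t) * z.re : ℝ) : ℍ[ℝ]) + J * ((z.im + t : ℝ) : ℍ[ℝ])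
  have hc : Continuous y := by
    have := Quaternion.continuous_coe
    fun_prop
  have h0 : y 0 = x := by simp [y, hJx]
  have h1 : ∀ᶠ t in 𝓝[>] (0 : ℝ), y t ∈ U :=
    (hc.continuousAt.mono_left nhdsWithin_le_nhds).eventually (hU.mem_nhds (by rwa [h0]))
  obtain ⟨t, ht, ht0⟩ := (h1.and self_mem_nhdsWithin).exists
  have ht0 : 0 < t := ht0
  have h2 : ‖(y t).im‖ = z.im + t := by
    rw [norm_im_slice hJ, abs_of_nonneg (by positivity)]
  refine ⟨y t, ht, ?_, ?_⟩
  · rw [← norm_ne_zero_iff, h2]; positivity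
  · have h3 : ‖y t‖ ^ 2 = ((1 + t) * z.re) ^ 2 + (z.im + t) ^ 2 := by
      rw [norm_sq_eq, h2, re_slice hJ]
    have h4 : ‖x‖ ^ 2 = z.re ^ 2 + z.im ^ 2 := norm_sq_eq x
    refine lt_of_pow_lt_pow_left₀ 2 (norm_nonneg _) ?_
    rw [h3, h4]
    nlinarith [mul_nonneg ht0.le (sq_nonneg z.re), mul_nonneg (sq_nonneg t) (sq_nonneg z.re),
      mul_nonneg ht0.le hz0, mul_pos ht0 ht0]

/-- A real power series with partial sums tending to zero on a neighbourhood of `1` vanishes. -/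
theorem eq_zero_of_tendsto_near_one {c : ℕ → ℍ[ℝ]}
    (h : ∀ᶠ t : ℝ in 𝓝 1,
      Tendsto (fun N => ∑ n ∈ Finset.range N, t ^ n • c n) atTop (𝓝 0)) : c = 0 := by
  -- Convergence at some `t₀ > 1` puts `1` strictly inside the interval of convergence, so the
  -- identity theorem carries the vanishing from `1` to `0`.
  obtain ⟨t₀, ht₀, h1⟩ : ∃ t₀ : ℝ,
      Tendsto (fun N => ∑ n ∈ Finset.range N, t₀ ^ n • c n) atTop (𝓝 0) ∧ 1 < t₀ :=
    ((h.filter_mono nhdsWithin_le_nhds).and (self_mem_nhdsWithin (s := Set.Ioi (1 : ℝ)))).exists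
  obtain ⟨C, hC⟩ := exists_bound_of_tendsto ht₀
  have h0 : 0 ≤ t₀ := by linarith
  let p : FormalMultilinearSeries ℝ ℝ ℍ[ℝ] := fun n =>
    ContinuousMultilinearMap.mkPiRing ℝ (Fin n) (c n)
  have hp (n : ℕ) (t : ℝ) : (p n fun _ => t) = t ^ n • c n := by
    simp [p, ContinuousMultilinearMap.mkPiRing_apply]
  have hr : (t₀.toNNReal : ENNReal) ≤ p.radius := by
    refine p.le_radius_of_bound C fun n => ?_
    rw [Real.coe_toNNReal _ h0]
    have : ‖p n‖ = ‖c n‖ := by simp [p]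
    rw [this]
    have := hC n
    rwa [norm_smul, norm_pow, Real.norm_of_nonneg h0, mul_comm] at this
  have h1' : (1 : NNReal) < t₀.toNNReal := by
    rw [← Real.toNNReal_one]; exact (Real.toNNReal_lt_toNNReal_iff (by linarith)).2 h1
  have hpos : 0 < p.radius := lt_of_lt_of_le (by
    exact_mod_cast zero_lt_one.trans h1') hr
  have hb := p.hasFPowerSeriesOnBall hpos
  have hmem : (1 : ℝ) ∈ Metric.eball (0 : ℝ) p.radius := by
    rw [Metric.mem_eball, edist_zero_right]
    refine lt_of_lt_of_le ?_ hr
    simpa using h1'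
  have hzero : p.sum =ᶠ[𝓝 1] 0 := by
    filter_upwards [h, Metric.isOpen_eball.mem_nhds hmem] with t ht htb
    have := (hb.hasSum htb).tendsto_sum_nat
    simp only [hp, zero_add] at this
    exact tendsto_nhds_unique this ht
  have hconv : IsPreconnected (Metric.eball (0 : ℝ) p.radius) :=
    (convex_eball (0 : ℝ) p.radius).isPreconnected
  have hz := hb.analyticOnNhd.eqOn_zero_of_preconnected_of_eventuallyEq_zero hconv hmem hzero
  have hs : HasFPowerSeriesAt 0 p (0 : ℝ) :=
    hb.hasFPowerSeriesAt.congr (eventually_of_mem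
      (Metric.isOpen_eball.mem_nhds (Metric.mem_eball_self hpos)) hz)
  have hp0 := hs.eq_zero
  funext n
  have := hp n 1
  rw [hp0] at this
  simpa using this.symm

section Expansion

variable {D : Set ℂ} {f : ℍ[ℝ] → ℍ[ℝ]}

theorem HasPExpansion.exists_coeffBound (h : HasPExpansion D f a) (hD : IsOpen D)
    (hconj : ∀ z ∈ D, conj z ∈ D) (hx : x ∈ axial D) : ∃ R, ‖x‖ < R ∧ CoeffBound a R := by
  obtain ⟨y, hy, hy0, hxy⟩ := exists_norm_lt (isOpen_axial hD hconj) hx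
  exact ⟨‖y‖, hxy, coeffBound_of_tendsto hy0 (h y hy)⟩

/-- The coefficients of an expansion `∑ P_n a_n` are unique. -/
theorem HasPExpansion.unique (ha : HasPExpansion D f a) (hb : HasPExpansion D f b)
    (hD : IsOpen D) (hconj : ∀ z ∈ D, conj z ∈ D) (hx : x ∈ axial D) : a = b := by
  obtain ⟨y, hy, hy0, -⟩ := exists_norm_lt (isOpen_axial hD hconj) hx
  have h1 : ∀ᶠ t : ℝ in 𝓝 1, t • y ∈ axial D := by
    have hc : Continuous fun t : ℝ => t • y := by fun_prop
    exact hc.continuousAt.eventually ((isOpen_axial hD hconj).mem_nhds (by simpa using hy))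
  -- Along the ray `t • y`, homogeneity turns the difference of the expansions into a power series
  -- in `t` that vanishes near `t = 1`.
  have h2 : (fun n => P n y * (a n - b n)) = 0 := by
    refine eq_zero_of_tendsto_near_one (h1.mono fun t ht => ?_)
    have := (ha _ ht).sub (hb _ ht)
    rw [sub_self] at this
    refine this.congr fun N => ?_
    rw [← Finset.sum_sub_distrib]
    refine Finset.sum_congr rfl fun n _ => ?_
    rw [P_smul, ← mul_sub, smul_mul_assoc]
  funext n
  exact sub_eq_zero.1 ((mul_eq_zero.1 (congrFun h2 n)).resolve_left (P_ne_zero n hy0))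

/-- The coefficients chosen in `lapInv` are the given ones by uniqueness; the point `x` guarantees
that `Ω` is nonempty, without which uniqueness fails. -/
theorem lapInv_eq (h : HasPExpansion D f a) (hD : IsOpen D) (hconj : ∀ z ∈ D, conj z ∈ D)
    (hx : x ∈ axial D) : lapInv D f x = -((4⁻¹ : ℝ) • powSum a x) := by
  have hf : f ∈ PSeries D := ⟨a, h⟩
  have hu : Exists.choose hf = a := HasPExpansion.unique (Exists.choose_spec hf) h hD hconj hx
  rw [lapInv, dif_pos hf, ← hu]
  rfl

theorem neg_smul_powSum (r : ℝ) (h : CoeffBound a R) (hx : ‖x‖ < R) :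
    powSum (fun n => -(r • a n)) x = -(r • powSum a x) := by
  refine HasSum.tsum_eq (((h.hasSum_powSum hx).const_smul r).neg.congr_fun fun n => ?_)
  rw [mul_neg, mul_smul_comm]

theorem CoeffBound.neg_smul (h : CoeffBound a R) (r : ℝ) :
    CoeffBound (fun n => -(r • a n)) R := by
  obtain ⟨C, hC⟩ := h
  refine ⟨‖r‖ * C, fun n => ?_⟩
  rw [norm_neg, norm_smul, mul_assoc]
  gcongr
  exact hC n

theorem norm_slice {J : ℍ[ℝ]} (hJ : J * J = -1) (z : ℂ) :
    ‖(z.re : ℍ[ℝ]) + J * (z.im : ℍ[ℝ])‖ = ‖z‖ := by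
  rw [← sq_eq_sq₀ (norm_nonneg _) (norm_nonneg _), norm_sq_eq, re_slice hJ, norm_im_slice hJ,
    sq_abs, ← Complex.normSq_eq_norm_sq, Complex.normSq_apply]
  ring

theorem HasPExpansion.exists_coeffBound_stem (h : HasPExpansion D f a) (hD : IsOpen D)
    (hconj : ∀ z ∈ D, conj z ∈ D) {z : ℂ} (hz : z ∈ D) : ∃ R, ‖z‖ < R ∧ CoeffBound a R := by
  have := h.exists_coeffBound hD hconj ⟨z, hz, qi, qi_mul_qi, rfl⟩
  rwa [norm_slice qi_mul_qi] at this

theorem HasPExpansion.hasSum_lapInv (h : HasPExpansion D f a) (hD : IsOpen D)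
    (hconj : ∀ z ∈ D, conj z ∈ D) (hx : x ∈ axial D) :
    HasSum (fun n => -((4⁻¹ : ℝ) • (x ^ (n + 2) * a n))) (lapInv D f x) := by
  obtain ⟨R, hR, hb⟩ := h.exists_coeffBound hD hconj hx
  rw [lapInv_eq h hD hconj hx]
  exact ((hb.hasSum_powSum hR).const_smul (4⁻¹ : ℝ)).neg

theorem SR_congr {g : ℍ[ℝ] → ℍ[ℝ]} (hf : f ∈ SR D) (h : ∀ x ∈ axial D, f x = g x) : g ∈ SR D := by
  obtain ⟨F₁, F₂, hs, hF, hi⟩ := hf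
  exact ⟨F₁, F₂, hs, hF, hi.congr h⟩

theorem lapInv_mem_SR (hf : f ∈ PSeries D) (hD : IsOpen D) (hconj : ∀ z ∈ D, conj z ∈ D) :
    lapInv D f ∈ SR D := by
  obtain ⟨a, ha⟩ := hf
  refine SR_congr (powSum_mem_SR (a := fun n => -((4⁻¹ : ℝ) • a n)) fun z hz => ?_) fun x hx => ?_
  · obtain ⟨R, hR, hb⟩ := ha.exists_coeffBound_stem hD hconj hz
    exact ⟨R, hR, hb.neg_smul _⟩
  · obtain ⟨R, hR, hb⟩ := ha.exists_coeffBound hD hconj hx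
    rw [neg_smul_powSum _ hb hR, lapInv_eq ha hD hconj hx]

theorem laplacian_lapInv (hf : f ∈ PSeries D) (hD : IsOpen D) (hconj : ∀ z ∈ D, conj z ∈ D)
    (hx : x ∈ axial D) : Δ (lapInv D f) x = f x := by
  obtain ⟨a, ha⟩ := hf
  obtain ⟨R, hR, hb⟩ := ha.exists_coeffBound hD hconj hx
  have hc : ContDiffAt ℝ 2 (powSum a) x := contDiffAt_of_mem_SR
    (powSum_mem_SR fun z hz => ha.exists_coeffBound_stem hD hconj hz) hD hconj hx
  have h1 : lapInv D f =ᶠ[𝓝 x] -((4⁻¹ : ℝ) • powSum a) :=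
    eventually_of_mem ((isOpen_axial hD hconj).mem_nhds hx) fun y hy => lapInv_eq ha hD hconj hy
  rw [(InnerProductSpace.laplacian_congr_nhds h1).eq_of_nhds, InnerProductSpace.laplacian_neg,
    Pi.neg_apply, InnerProductSpace.laplacian_smul _ hc]
  -- Both sides are limits of the same partial sums `∑ P_n(x) a_n`.
  exact tendsto_nhds_unique (hb.hasSum_laplacian hR hc).tendsto_sum_nat (ha x hx)

theorem isRightInverse_lapInv (hD : IsOpen D) (hconj : ∀ z ∈ D, conj z ∈ D) :
    IsRightInverse D (PSeries D) (lapInv D) where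
  subset_AM _ hf := AM_congr hD hconj (laplacian_mem_AM hD hconj (lapInv_mem_SR hf hD hconj))
    fun _ hx => (laplacian_lapInv hf hD hconj hx).symm
  mem_SR _ hf := lapInv_mem_SR hf hD hconj
  laplacian_eq _ hf _ hx := laplacian_lapInv hf hD hconj hx

theorem P_mem_PSeries (n : ℕ) : P n ∈ PSeries D := by
  refine ⟨Pi.single n 1, fun x _ => ?_⟩
  have h := hasSum_single (f := fun m => P m x * (Pi.single n 1 : ℕ → ℍ[ℝ]) m) n fun m hm => by
    rw [Pi.single_eq_of_ne hm, mul_zero]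
  rw [Pi.single_eq_same, mul_one] at h
  exact h.tendsto_sum_nat

end Expansion

end Series

end SliceAnalysis

end

theorem proposition4p5 (D : Set ℂ) (hD : IsOpen D) (hconj : ∀ z ∈ D, conj z ∈ D) :
    -- the operators map between the stated function classes
    (∀ g ∈ SR D, Δ g ∈ AM D ∧ sliceDeriv g ∈ SR D) ∧
    -- the explicit operator is well defined and is a right inverse of the Laplacian
    (∀ f a, HasPExpansion D f a → ∀ x ∈ axial D,
      HasSum (fun n => -((4⁻¹ : ℝ) • (x ^ (n + 2) * a n))) (lapInv D f x)) ∧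
    IsRightInverse D (PSeries D) (lapInv D) ∧
    (∀ n, P n ∈ PSeries D) ∧
    -- the conjugated Fueter operator on the polynomials
    (∀ n : ℕ, 1 ≤ n → ∀ x, conjFueter (P n) x = ((n : ℝ) + 2) • P (n - 1) x) ∧
    -- the operator `L`, for any chosen right inverse
    (∀ M T, IsRightInverse D M T →
      (∀ n : ℕ, 1 ≤ n → P n ∈ M → ∀ x ∈ axial D, L T (P n) x = ((n : ℝ) + 2) • P (n - 1) x) ∧
      (∀ f ∈ M, L T f ∈ AM D ∧ ∀ x ∈ axial D, L T f x = conjFueter f x)) ∧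
    -- the commutation relation on slice-regular functions
    (∀ g ∈ SR D, ∀ x ∈ axial D, conjFueter (Δ g) x = Δ (sliceDeriv g) x) := by
  refine ⟨fun g hg => ⟨laplacian_mem_AM hD hconj hg, sliceDeriv_mem_SR hD hconj hg⟩,
    fun f a h x hx => h.hasSum_lapInv hD hconj hx, isRightInverse_lapInv hD hconj,
    P_mem_PSeries, fun n hn x => conjFueter_P hn x, fun M T hT => ?_,
    fun g hg x hx => conjFueter_laplacian_of_mem_SR hD hconj hg hx⟩
  -- The commutation relation for `T f` gives `L T f = ∂̄(Δ(T f))`, and `Δ(T f) = f` on a whole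
  -- neighbourhood of `x`, so the values of `∂̄` agree.
  have key : ∀ f ∈ M, ∀ x ∈ axial D, L T f x = conjFueter f x := fun f hf x hx => by
    rw [L, ← conjFueter_laplacian_of_mem_SR hD hconj (hT.mem_SR f hf) hx]
    exact conjFueter_congr (Filter.eventually_of_mem ((isOpen_axial hD hconj).mem_nhds hx)
      (hT.laplacian_eq f hf))
  exact ⟨fun n hn hM x hx => (key _ hM x hx).trans (conjFueter_P hn x),
    fun f hf => ⟨laplacian_mem_AM hD hconj (sliceDeriv_mem_SR hD hconj (hT.mem_SR f hf)), key f hf⟩⟩
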